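/- Let $k$ be a field of characteristic $0$ and let $V=V_0\oplus V_1$ be a $\mathbb Z_2$-graded vector space over $k$ with an inner product $\langle\cdot,\cdot\rangle$, that is, an even, graded symmetric ($\langle v,w\rangle=(-1)^{|v||w|}\langle w,v\rangle$), nondegenerate bilinear form. Let $W=\Pi V$ be the parity reversion, with the odd identity map $\pi:V\to W$, and let $\bigodot W=\bigoplus_{n\ge1}\bigodot^nW$ be the reduced graded symmetric coalgebra. A cochain is a linear map $\varphi:\bigodot W\to W$, or equivalently the family of graded antisymmetric maps $\varphi_n:V^n\to V$, $n\ge 1$, $$\varphi_n(v_1,\dots,v_n)=(-1)^{(n-1)|v_1|+(n-2)|v_2|+\cdots+|v_{n-1}|}\,\pi^{-1}\varphi(\pi v_1\odot\cdots\odot\pi v_n);$$ $\hat\varphi$ denotes the coderivation of $\bigodot W$ that extends $\varphi$. If $\varphi$ has parity $r$ as a map $\bigodot W\to W$, then $\varphi_n$ has parity $r+n+1$, and $\varphi$ is called cyclic if for all $n\ge1$ $$\langle\varphi_n(v_1,\dots,v_n),v_{n+1}\rangle=(-1)^{n+|v_1||\varphi_n|}\langle v_1,\varphi_n(v_2,\dots,v_{n+1})\rangle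 .$$ Let $l$ be an $L_\infty$ structure on $V$ (an odd cochain $l:\bigodot W\to W$ with $\hat l^2=0$) for which the inner product is invariant, i.e. $l$ is cyclic. Let $CC^r$ be the space of cyclic cochains of parity $r\in\mathbb Z_2$, and put $D\varphi=[\varphi,l]=\varphi\circ\hat l-(-1)^{r}\,l\circ\hat\varphi$ for $\varphi$ of parity $r$. Let $t$ be a parameter of parity $p\in\mathbb Z_2$ with $t^2=0$ that commutes with everything up to the Koszul sign. An infinitesimal deformation of $l$ is $l_t=l+t\varphi$, $\varphi$ a cochain, such that $\hat l+t\hat\varphi$ is odd and of square zero on $\bigodot W[t]$; it preserves the inner product if the inner product, extended to $V[t]$, is invariant for $l_t$. Two such deformations are called equivalent if an even $k[t]$-linear automorphism $F$ of the coalgebra $\bigodot W[t]$, equal to the identity modulo $t$ and preserving the inner product, carries the first codifferential to the second; a deformation is trivial if it is equivalent to $l$. Here $F$, with components $f:\bigodot W\to W[t]$, preserves the inner product if it preserves, as a formal change of coordinates, the form $\omega(\pi a,\pi b)=(-1)^{|a|}\langle a,b\rangle$ on $W$: for homogeneous $u,w\in W$ and $x=w_1\odot\cdots\odot w_m$, $m\ge0$,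 $$\sum(-1)^{|u||x''|}\,\omega\big(f(x'\odot u),f(x''\odot w)\big)=\begin{cases}\omega(u,w)&m=0,\\0&m>0,\end{cases}$$ where $\sum x'\otimes x''$ is the full coproduct of $x$ (for linear $F$ this says that $F$ preserves $\langle\cdot,\cdot\rangle$). Then: (a) $D$ maps $CC^r$ to $CC^{r+1}$ and $D^2=0$ on $CC^r$, so that the cyclic cohomology $HC(V)=HC^0(V)\oplus HC^1(V)$, $HC^r(V)=\ker(D|_{CC^r})/D(CC^{r+1})$, is defined. And for each parity $p$ of $t$: (b) $l+t\varphi$ is an infinitesimal deformation of $l$ that preserves the inner product if and only if $\varphi$ is a cyclic cocycle of parity $p+1$. (c) $l+t\varphi$ is a trivial infinitesimal deformation preserving the inner product if and only if $\varphi\in D(CC^{p})$, i.e. $\varphi$ is a cyclic coboundary of parity $p+1$; two infinitesimal deformations $l+t\varphi$, $l+t\psi$ that preserve the inner product are equivalent if and only if $\psi-\varphi\in D(CC^{p})$. (d) Consequently $[\varphi]\mapsto[l+t\varphi]$ is a well-defined bijection from $HC^{p+1}(V)$ onto the set of equivalence classes of infinitesimal deformations of $l$, with parameter of parity $p$, that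 preserve the inner product. -/

import Mathlib

open scoped TensorProduct

noncomputable section

namespace LInf

/-! ### Parities and signs -/

section Parity

variable (K : Type*) [Field K]

/-- The sign `(-1)^i` of a parity `i`. -/
def sgn (i : ZMod 2) : K := if i = 0 then 1 else -1

variable {K} {W : Type*} [AddCommGroup W] [Module K W]

/-- Parity reversion: the same space, with the parity of the elements reversed. The map `π` from
a space to its parity reversion is the identity on elements. -/
def rev (𝒲 : ZMod 2 → Submodule K W) : ZMod 2 → Submodule K W := fun i => 𝒲 (i + 1)

theorem le_rev (𝒲 : ZMod 2 → Submodule K W) (i : ZMod 2) : 𝒲 i ≤ rev 𝒲 (i + 1) := by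
  have h : i + 1 + 1 = i := by revert i; decide
  intro x hx
  simpa only [rev, h] using hx

instance instDecompositionRev (𝒲 : ZMod 2 → Submodule K W) [DirectSum.Decomposition 𝒲] :
    DirectSum.Decomposition (rev 𝒲) :=
  DirectSum.Decomposition.ofLinearMap (rev 𝒲)
    (DirectSum.toModule K (ZMod 2) _
        (fun i => DirectSum.lof K (ZMod 2) (fun j => rev 𝒲 j) (i + 1) ∘ₗ
          Submodule.inclusion (le_rev 𝒲 i)) ∘ₗ
      (DirectSum.decomposeLinearEquiv 𝒲).toLinearMap)
    (by
      refine LinearMap.ext fun x => ?_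
      induction x using DirectSum.Decomposition.inductionOn 𝒲 with
      | zero => simp
      | homogeneous m => simp
      | add a b ha hb => rw [map_add, ha, hb, map_add])
    (by
      refine DirectSum.linearMap_ext K fun i => LinearMap.ext fun x => ?_
      have h : i = i + 1 + 1 := by
        clear x
        revert i
        decide
      obtain ⟨x, hx⟩ := x
      have e : DirectSum.decompose 𝒲 x =
          DirectSum.lof K (ZMod 2) (fun j => 𝒲 j) (i + 1) ⟨x, hx⟩ :=
        DirectSum.decompose_of_mem 𝒲 hx
      simp only [LinearMap.comp_apply, DirectSum.coeLinearMap_lof, LinearEquiv.coe_coe,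
        DirectSum.decomposeLinearEquiv_apply, e, DirectSum.toModule_lof, LinearMap.id_apply]
      refine DFinsupp.single_eq_of_sigma_eq (Sigma.ext h.symm ?_)
      congr!
      exact h.symm)

/-- The projection onto the homogeneous component of parity `i`. -/
def grProj (𝒲 : ZMod 2 → Submodule K W) [DirectSum.Decomposition 𝒲] (i : ZMod 2) : W →ₗ[K] W :=
  (𝒲 i).subtype ∘ₗ DirectSum.component K (ZMod 2) (fun j => 𝒲 j) i ∘ₗ
    (DirectSum.decomposeLinearEquiv 𝒲).toLinearMap

theorem grProj_of_mem (𝒲 : ZMod 2 → Submodule K W) [DirectSum.Decomposition 𝒲] {i : ZMod 2}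
    {w : W} (hw : w ∈ 𝒲 i) (j : ZMod 2) : grProj 𝒲 j w = if j = i then w else 0 := by
  change ((DirectSum.decompose 𝒲 w j : 𝒲 j) : W) = _
  split_ifs with h
  · subst h
    exact DirectSum.decompose_of_mem_same 𝒲 hw
  · exact DirectSum.decompose_of_mem_ne 𝒲 hw (Ne.symm h)

/-- The parity operator `w ↦ (-1)^|w| w`. -/
def parityOp (𝒲 : ZMod 2 → Submodule K W) [DirectSum.Decomposition 𝒲] : W →ₗ[K] W :=
  grProj 𝒲 0 - grProj 𝒲 1

theorem parityOp_of_mem (𝒲 : ZMod 2 → Submodule K W) [DirectSum.Decomposition 𝒲] {i : ZMod 2}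
    {w : W} (hw : w ∈ 𝒲 i) : parityOp 𝒲 w = sgn K i • w := by
  simp only [parityOp, LinearMap.sub_apply, grProj_of_mem 𝒲 hw]
  obtain rfl | rfl : i = 0 ∨ i = 1 := by
    clear hw
    revert i
    decide
  · simp [sgn]
  · simp [sgn]

/-- Given the parity operator `P` of a space, the operator `x ↦ (-1)^(i|x|) x`. -/
def tw {M : Type*} [AddCommMonoid M] [Module K M] (i : ZMod 2) (P : M →ₗ[K] M) : M →ₗ[K] M :=
  if i = 0 then LinearMap.id else P

/-- A linear map between spaces with parity operators `P` and `Q` is homogeneous of parity `r`. -/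
def HasParity {M N : Type*} [AddCommMonoid M] [Module K M] [AddCommMonoid N] [Module K N]
    (P : M →ₗ[K] M) (Q : N →ₗ[K] N) (r : ZMod 2) (f : M →ₗ[K] N) : Prop :=
  Q ∘ₗ f = sgn K r • (f ∘ₗ P)

end Parity

/-! ### The graded symmetric algebra and the reduced symmetric coalgebra -/

section Symmetric

variable {K : Type*} [Field K] {W : Type*} [AddCommGroup W] [Module K W]

/-- The relations `a ⊙ b = (-1)^(|a||b|) b ⊙ a`. -/
inductive SymRel (𝒲 : ZMod 2 → Submodule K W) : TensorAlgebra K W → TensorAlgebra K W → Prop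
  | comm (i j : ZMod 2) (a b : W) (ha : a ∈ 𝒲 i) (hb : b ∈ 𝒲 j) :
      SymRel 𝒲 (TensorAlgebra.ι K a * TensorAlgebra.ι K b)
        (sgn K (i * j) • (TensorAlgebra.ι K b * TensorAlgebra.ι K a))

/-- The graded symmetric algebra of `W`, with its unit. -/
def Sym (𝒲 : ZMod 2 → Submodule K W) : Type _ := RingQuot (SymRel 𝒲)

instance instRingSym (𝒲 : ZMod 2 → Submodule K W) : Ring (Sym 𝒲) :=
  inferInstanceAs (Ring (RingQuot (SymRel 𝒲)))

instance instAlgebraSym (𝒲 : ZMod 2 → Submodule K W) : Algebra K (Sym 𝒲) :=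
  inferInstanceAs (Algebra K (RingQuot (SymRel 𝒲)))

/-- The quotient map from the tensor algebra. -/
def symMk (𝒲 : ZMod 2 → Submodule K W) : TensorAlgebra K W →ₐ[K] Sym 𝒲 :=
  RingQuot.mkAlgHom K (SymRel 𝒲)

/-- The inclusion of `W` in its symmetric algebra. -/
def inc (𝒲 : ZMod 2 → Submodule K W) : W →ₗ[K] Sym 𝒲 :=
  (symMk 𝒲).toLinearMap ∘ₗ TensorAlgebra.ι K

theorem inc_mul_inc (𝒲 : ZMod 2 → Submodule K W) {i j : ZMod 2} {a b : W} (ha : a ∈ 𝒲 i)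
    (hb : b ∈ 𝒲 j) : inc 𝒲 a * inc 𝒲 b = sgn K (i * j) • (inc 𝒲 b * inc 𝒲 a) := by
  have h : symMk 𝒲 _ = symMk 𝒲 _ :=
    RingQuot.mkAlgHom_rel K (SymRel.comm (𝒲 := 𝒲) i j a b ha hb)
  simpa [inc] using h

/-- The universal property of the symmetric algebra. -/
def symLift (𝒲 : ZMod 2 → Submodule K W) {A : Type*} [Semiring A] [Algebra K A] (f : W →ₗ[K] A)
    (hf : ∀ (i j : ZMod 2) (a b : W), a ∈ 𝒲 i → b ∈ 𝒲 j →
      f a * f b = sgn K (i * j) • (f b * f a)) : Sym 𝒲 →ₐ[K] A :=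
  RingQuot.liftAlgHom K ⟨TensorAlgebra.lift K f, by
    rintro _ _ ⟨i, j, a, b, ha, hb⟩
    simpa using hf i j a b ha hb⟩

@[simp]
theorem symLift_inc (𝒲 : ZMod 2 → Submodule K W) {A : Type*} [Semiring A] [Algebra K A]
    (f : W →ₗ[K] A) (hf : ∀ (i j : ZMod 2) (a b : W), a ∈ 𝒲 i → b ∈ 𝒲 j →
      f a * f b = sgn K (i * j) • (f b * f a)) (w : W) : symLift 𝒲 f hf (inc 𝒲 w) = f w := by
  have h : symLift 𝒲 f hf (inc 𝒲 w) = TensorAlgebra.lift K f (TensorAlgebra.ι K w) :=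
    RingQuot.liftAlgHom_mkAlgHom_apply K _ _ _
  rw [h, TensorAlgebra.lift_ι_apply]

/-- The augmentation: it is the identity on scalars and kills `W`. -/
def aug (𝒲 : ZMod 2 → Submodule K W) : Sym 𝒲 →ₐ[K] K :=
  symLift 𝒲 0 (by simp)

/-- The algebra map that underlies the projection to the part of degree one: `w` acts on `K × W`
by `(c, v) ↦ (0, c w)`. -/
def degOneAux (𝒲 : ZMod 2 → Submodule K W) : Sym 𝒲 →ₐ[K] Module.End K (K × W) :=
  symLift 𝒲
    { toFun := fun w =>
        LinearMap.inr K K W ∘ₗ LinearMap.toSpanSingleton K W w ∘ₗ LinearMap.fst K K W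
      map_add' := fun a b => by ext <;> simp
      map_smul' := fun c a => by ext <;> simp }
    (by
      intro i j a b _ _
      ext <;> simp)

/-- The projection of the symmetric algebra onto its part `W` of degree one. -/
def degOne (𝒲 : ZMod 2 → Submodule K W) : Sym 𝒲 →ₗ[K] W :=
  LinearMap.snd K K W ∘ₗ LinearMap.applyₗ (1, 0) ∘ₗ (degOneAux 𝒲).toLinearMap

/-- The reduced symmetric coalgebra, as a space: the sum of the symmetric powers `⊙ⁿ W`
for `n ≥ 1`. -/
abbrev RSym (𝒲 : ZMod 2 → Submodule K W) : Type _ := ↥(LinearMap.ker (aug 𝒲).toLinearMap)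

/-- The projection of the symmetric algebra onto its part of positive degree. -/
def red (𝒲 : ZMod 2 → Submodule K W) : Sym 𝒲 →ₗ[K] RSym 𝒲 :=
  LinearMap.codRestrict _
    (LinearMap.id - Algebra.linearMap K (Sym 𝒲) ∘ₗ (aug 𝒲).toLinearMap)
    (fun x => by simp)

/-- The inclusion of the part of positive degree. -/
def incl (𝒲 : ZMod 2 → Submodule K W) : RSym 𝒲 →ₗ[K] Sym 𝒲 :=
  (LinearMap.ker (aug 𝒲).toLinearMap).subtype

variable (𝒲 : ZMod 2 → Submodule K W) [DirectSum.Decomposition 𝒲]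

/-- The parity operator of the symmetric algebra,
`w₁ ⊙ ⋯ ⊙ wₙ ↦ (-1)^(|w₁| + ⋯ + |wₙ|) w₁ ⊙ ⋯ ⊙ wₙ`. -/
def symPar : Sym 𝒲 →ₐ[K] Sym 𝒲 :=
  symLift 𝒲 (inc 𝒲 ∘ₗ parityOp 𝒲) (by
    intro i j a b ha hb
    simp only [LinearMap.comp_apply, parityOp_of_mem 𝒲 ha, parityOp_of_mem 𝒲 hb, map_smul,
      smul_mul_smul_comm, inc_mul_inc 𝒲 ha hb, smul_smul]
    ring_nf)

theorem symPar_inc_mul {i : ZMod 2} {w : W} (hw : w ∈ 𝒲 i) (x : Sym 𝒲) :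
    symPar 𝒲 (inc 𝒲 w * x) = sgn K i • (inc 𝒲 w * symPar 𝒲 x) := by
  have h : symPar 𝒲 (inc 𝒲 w) = sgn K i • inc 𝒲 w := by
    rw [symPar, symLift_inc, LinearMap.comp_apply, parityOp_of_mem 𝒲 hw, map_smul]
  rw [map_mul, h, smul_mul_assoc]

/-- Left multiplication by `w ⊗ 1 + 1 ⊗ w` on `Sym ⊗ Sym`, with the Koszul sign rule:
`x ⊗ y ↦ (w ⊙ x) ⊗ y + (-1)^(|w||x|) x ⊗ (w ⊙ y)`. -/
def primMul : W →ₗ[K] Module.End K (Sym 𝒲 ⊗[K] Sym 𝒲) where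
  toFun w := TensorProduct.map (LinearMap.mulLeft K (inc 𝒲 w)) LinearMap.id +
    ∑ i : ZMod 2, TensorProduct.map (tw i (symPar 𝒲).toLinearMap)
      (LinearMap.mulLeft K (inc 𝒲 (grProj 𝒲 i w)))
  map_add' a b := by
    ext x y
    simp [add_mul, TensorProduct.add_tmul, TensorProduct.tmul_add, Finset.sum_add_distrib]
    abel
  map_smul' c a := by
    ext x y
    simp [TensorProduct.smul_tmul', Finset.smul_sum]

theorem primMul_tmul {i : ZMod 2} {w : W} (hw : w ∈ 𝒲 i) (x y : Sym 𝒲) :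
    primMul 𝒲 w (x ⊗ₜ y) = (inc 𝒲 w * x) ⊗ₜ[K] y +
      tw i (symPar 𝒲).toLinearMap x ⊗ₜ[K] (inc 𝒲 w * y) := by
  have h : ∀ j, TensorProduct.map (tw j (symPar 𝒲).toLinearMap)
      (LinearMap.mulLeft K (inc 𝒲 (grProj 𝒲 j w))) (x ⊗ₜ[K] y) =
      if j = i then tw i (symPar 𝒲).toLinearMap x ⊗ₜ[K] (inc 𝒲 w * y) else 0 := by
    intro j
    rw [grProj_of_mem 𝒲 hw]
    split_ifs with hj
    · subst hj; simp
    · simp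
  simp [primMul, LinearMap.sum_apply, h]

/-- The algebra map by which `Sym` acts on `Sym ⊗ Sym` through the coproduct. -/
def coprodAux : Sym 𝒲 →ₐ[K] Module.End K (Sym 𝒲 ⊗[K] Sym 𝒲) :=
  symLift 𝒲 (primMul 𝒲) (by
    intro i j a b ha hb
    have key : ∀ (k l : ZMod 2) (c : W), c ∈ 𝒲 k → ∀ x : Sym 𝒲,
        tw l (symPar 𝒲).toLinearMap (inc 𝒲 c * x) =
          sgn K (l * k) • (inc 𝒲 c * tw l (symPar 𝒲).toLinearMap x) := by
      intro k l c hc x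
      obtain rfl | rfl : l = 0 ∨ l = 1 := by
        revert l
        decide
      · simp [tw, sgn]
      · simp [tw, symPar_inc_mul 𝒲 hc]
    have comm : ∀ x : Sym 𝒲, tw i (symPar 𝒲).toLinearMap (tw j (symPar 𝒲).toLinearMap x) =
        tw j (symPar 𝒲).toLinearMap (tw i (symPar 𝒲).toLinearMap x) := by
      intro x
      simp only [tw]
      split_ifs <;> simp
    have assoc : ∀ x : Sym 𝒲, inc 𝒲 a * (inc 𝒲 b * x) =
        sgn K (i * j) • (inc 𝒲 b * (inc 𝒲 a * x)) := by
      intro x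
      rw [← mul_assoc, inc_mul_inc 𝒲 ha hb, smul_mul_assoc, mul_assoc]
    have hs : sgn K (i * j) * sgn K (i * j) = 1 := by
      simp only [sgn]; split_ifs <;> simp
    refine TensorProduct.ext' fun x y => ?_
    simp only [Module.End.mul_apply, LinearMap.smul_apply, primMul_tmul 𝒲 ha,
      primMul_tmul 𝒲 hb, map_add, key _ _ _ ha, key _ _ _ hb, comm, assoc, smul_add,
      TensorProduct.smul_tmul', TensorProduct.tmul_smul, smul_smul, mul_comm j i, hs, one_smul]
    abel)

/-- The coproduct of the symmetric algebra, the map that is multiplicative for the Koszul sign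
rule with `w ↦ w ⊗ 1 + 1 ⊗ w`. On a product it is the signed sum over unshuffles
`∑ₖ ∑_σ ε(σ) (w_σ(1) ⊙ ⋯ ⊙ w_σ(k)) ⊗ (w_σ(k+1) ⊙ ⋯ ⊙ w_σ(n))`, for `0 ≤ k ≤ n`. -/
def coprod : Sym 𝒲 →ₗ[K] Sym 𝒲 ⊗[K] Sym 𝒲 :=
  LinearMap.applyₗ (1 ⊗ₜ[K] 1) ∘ₗ (coprodAux 𝒲).toLinearMap

theorem coprod_one : coprod 𝒲 1 = 1 ⊗ₜ[K] 1 := by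
  simp [coprod]

theorem coprod_inc_mul (w : W) (x : Sym 𝒲) :
    coprod 𝒲 (inc 𝒲 w * x) = primMul 𝒲 w (coprod 𝒲 x) := by
  simp [coprod, coprodAux]

/-- The parity operator of the reduced symmetric coalgebra. -/
def rPar : RSym 𝒲 →ₗ[K] RSym 𝒲 := red 𝒲 ∘ₗ (symPar 𝒲).toLinearMap ∘ₗ incl 𝒲

/-- The diagonal of the reduced symmetric coalgebra (the terms `1 ⊗ x` and `x ⊗ 1` of the
coproduct are left out: unshuffles with `1 ≤ k ≤ n - 1`). -/
def rDiag : RSym 𝒲 →ₗ[K] RSym 𝒲 ⊗[K] RSym 𝒲 :=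
  TensorProduct.map (red 𝒲) (red 𝒲) ∘ₗ coprod 𝒲 ∘ₗ incl 𝒲

/-- The coderivation of the reduced symmetric coalgebra that extends `φ : ⊙W → W`:
`w₁ ⊙ ⋯ ⊙ wₙ ↦ ∑ₖ ∑_σ ε(σ) φₖ(w_σ(1), …, w_σ(k)) ⊙ w_σ(k+1) ⊙ ⋯ ⊙ w_σ(n)`,
over `1 ≤ k ≤ n` and unshuffles `σ` of type `(k, n - k)`. -/
def hat : (RSym 𝒲 →ₗ[K] W) →ₗ[K] (RSym 𝒲 →ₗ[K] RSym 𝒲) where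
  toFun φ := red 𝒲 ∘ₗ LinearMap.mul' K (Sym 𝒲) ∘ₗ
    TensorProduct.map (inc 𝒲 ∘ₗ φ ∘ₗ red 𝒲) LinearMap.id ∘ₗ coprod 𝒲 ∘ₗ incl 𝒲
  map_add' φ ψ := by
    simp only [LinearMap.add_comp, LinearMap.comp_add, TensorProduct.map_add_left]
  map_smul' c φ := by
    simp only [LinearMap.smul_comp, LinearMap.comp_smul, TensorProduct.map_smul_left,
      RingHom.id_apply]

end Symmetric

/-! ### Extension of scalars to `K[t]`, `t² = 0`, with `t` of parity `p`

The space `M[t] = M ⊕ tM` is `M × M`, where `(x, y)` stands for `x + t y`. The parameter `t`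
commutes with everything up to the Koszul sign. -/

section Infinitesimal

variable {K : Type*} [Field K] {M N R : Type*} [AddCommMonoid M] [Module K M] [AddCommMonoid N]
  [Module K N] [AddCommMonoid R] [Module K R]

/-- The parity operator of `M[t]`. -/
def parT (p : ZMod 2) (P : M →ₗ[K] M) : (M × M) →ₗ[K] (M × M) :=
  LinearMap.prodMap P (sgn K p • P)

/-- Multiplication by `t`. -/
def mulT : (M × M) →ₗ[K] (M × M) := LinearMap.inr K M M ∘ₗ LinearMap.fst K M M

/-- The `t`-linear operator `A + tB` on `M[t]`, for `A` of parity `a`: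
`(A + tB)(x + t y) = A x + t (B x + (-1)^(pa) A y)`. -/
def opT (p a : ZMod 2) (A B : M →ₗ[K] M) : (M × M) →ₗ[K] (M × M) :=
  LinearMap.prod (A ∘ₗ LinearMap.fst K M M)
    (B ∘ₗ LinearMap.fst K M M + sgn K (p * a) • (A ∘ₗ LinearMap.snd K M M))

/-- The `t`-bilinear extension of an even bilinear map `β` on `M × N`, where `P` is the parity
operator of `M`: `β(a + t b, c + t d) = β(a, c) + t (β(b, c) + (-1)^(p|a|) β(a, d))`. -/
def bilT (p : ZMod 2) (P : M →ₗ[K] M) (β : M →ₗ[K] N →ₗ[K] R) :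
    (M × M) →ₗ[K] (N × N) →ₗ[K] (R × R) :=
  LinearMap.mk₂ K (fun x y => (β x.1 y.1, β x.2 y.1 + β (tw p P x.1) y.2))
    (fun x x' y => by ext <;> simp; abel)
    (fun c x y => by ext <;> simp)
    (fun x y y' => by ext <;> simp; abel)
    (fun c x y => by ext <;> simp)

end Infinitesimal

/-! ### `L∞` algebras, inner products, cyclic cohomology -/

section Cochains

variable {K : Type*} [Field K] {V : Type*} [AddCommGroup V] [Module K V]
variable (𝒱 : ZMod 2 → Submodule K V)

/-- The module of cochains of the graded space `V`, in terms of the parity reversion `W` of `V`: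
`C(V) ≅ C(W) = Hom(⊙W, W)`. The corresponding graded antisymmetric maps `Vⁿ → V` are given
by `component`. -/
abbrev Cochain : Type _ := RSym (rev 𝒱) →ₗ[K] V

/-- The `n`-th component `φₙ : Vⁿ → V` of a cochain, at homogeneous `v₁, …, vₙ` of parities
`i₁, …, iₙ`: `φₙ(v₁, …, vₙ) = (-1)^((n-1)v₁ + ⋯ + vₙ₋₁) π⁻¹ φ(πv₁ ⊙ ⋯ ⊙ πvₙ)`. The values may
lie in `V` or in `V[t]`. -/
def component {X : Type*} [AddCommMonoid X] [Module K X] (φ : RSym (rev 𝒱) →ₗ[K] X) {n : ℕ}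
    (i : Fin n → ZMod 2) (v : Fin n → V) : X :=
  sgn K (∑ k : Fin n, ((n - 1 - (k : ℕ) : ℕ) : ZMod 2) * i k) •
    φ (red (rev 𝒱) (List.ofFn fun k => inc (rev 𝒱) (v k)).prod)

/-- An even inner product: a bilinear form that is even, graded symmetric and nondegenerate. -/
structure IsInnerProduct (B : LinearMap.BilinForm K V) : Prop where
  even : ∀ (i j : ZMod 2) (x y : V), x ∈ 𝒱 i → y ∈ 𝒱 j → i ≠ j → B x y = 0
  symm : ∀ (i j : ZMod 2) (x y : V), x ∈ 𝒱 i → y ∈ 𝒱 j → B x y = sgn K (i * j) * B y x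
  nondegenerate : B.Nondegenerate

/-- A cochain `φ` that is of parity `r` on `W` (so that `φₙ` has parity `r + n + 1` on `V`) is
cyclic if
`⟨φₙ(v₁, …, vₙ), vₙ₊₁⟩ = (-1)^(n + v₁ φₙ) ⟨v₁, φₙ(v₂, …, vₙ₊₁)⟩` for all `n ≥ 1`. -/
def IsCyclicCochain (B : LinearMap.BilinForm K V) (r : ZMod 2) (φ : Cochain 𝒱) : Prop :=
  ∀ (n : ℕ) (i : Fin (n + 1) → ZMod 2) (v : Fin (n + 1) → V), 1 ≤ n → (∀ k, v k ∈ 𝒱 (i k)) →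
    B (component 𝒱 φ (fun k => i (Fin.castSucc k)) (fun k => v (Fin.castSucc k)))
        (v (Fin.last n)) =
      sgn K ((n : ZMod 2) + i 0 * (r + n + 1)) *
        B (v 0) (component 𝒱 φ (fun k => i (Fin.succ k)) (fun k => v (Fin.succ k)))

variable [DirectSum.Decomposition 𝒱]

/-- An `L∞` structure: an odd cochain `l` on `W` whose coderivation has square zero. -/
structure IsLInfty (l : Cochain 𝒱) : Prop where
  odd : HasParity (rPar (rev 𝒱)) (parityOp (rev 𝒱)) 1 l
  sq_zero : hat (rev 𝒱) l ∘ₗ hat (rev 𝒱) l = 0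

/-- The coboundary `D φ = [φ, l] = φ ∘ l̂ - (-1)^r l ∘ φ̂` on cochains `φ` of parity `r`. -/
def cobd (l : Cochain 𝒱) (r : ZMod 2) : Cochain 𝒱 →ₗ[K] Cochain 𝒱 :=
  LinearMap.lcomp K V (hat (rev 𝒱) l) -
    sgn K r • (LinearMap.llcomp K (RSym (rev 𝒱)) (RSym (rev 𝒱)) V l ∘ₗ hat (rev 𝒱))

/-- The cyclic cochains of parity `r`. -/
def CC (B : LinearMap.BilinForm K V) (r : ZMod 2) : Submodule K (Cochain 𝒱) where
  carrier := {φ | HasParity (rPar (rev 𝒱)) (parityOp (rev 𝒱)) r φ ∧ IsCyclicCochain 𝒱 B r φ}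
  zero_mem' := ⟨by simp [HasParity], fun n i v _ _ => by simp [component]⟩
  add_mem' := by
    rintro φ ψ ⟨h1, h2⟩ ⟨h3, h4⟩
    refine ⟨?_, fun n i v hn hv => ?_⟩
    · unfold HasParity at *
      rw [LinearMap.comp_add, h1, h3, LinearMap.add_comp, smul_add]
    · have e1 := h2 n i v hn hv
      have e2 := h4 n i v hn hv
      simp only [component, LinearMap.add_apply, smul_add, map_add] at e1 e2 ⊢
      rw [e1, e2]
      exact (mul_add _ _ _).symm
  smul_mem' := by
    rintro c φ ⟨h1, h2⟩
    refine ⟨?_, fun n i v hn hv => ?_⟩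
    · unfold HasParity at *
      rw [LinearMap.comp_smul, h1, LinearMap.smul_comp, smul_comm]
    · have e1 := h2 n i v hn hv
      simp only [component, LinearMap.smul_apply, map_smul, smul_eq_mul] at e1 ⊢
      linear_combination c * e1

/-- The cyclic cocycles of parity `r`. -/
def cocycles (B : LinearMap.BilinForm K V) (l : Cochain 𝒱) (r : ZMod 2) :
    Submodule K (Cochain 𝒱) :=
  CC 𝒱 B r ⊓ LinearMap.ker (cobd 𝒱 l r)

/-- The cyclic coboundaries of parity `r`: the coboundaries of cyclic cochains of parity `r + 1`
(which is `r - 1`). -/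
def coboundaries (B : LinearMap.BilinForm K V) (l : Cochain 𝒱) (r : ZMod 2) :
    Submodule K (Cochain 𝒱) :=
  (CC 𝒱 B (r + 1)).map (cobd 𝒱 l (r + 1))

/-- The part of parity `r` of the cyclic cohomology, `HC(V) = HC⁰(V) ⊕ HC¹(V)`. -/
abbrev HC (B : LinearMap.BilinForm K V) (l : Cochain 𝒱) (r : ZMod 2) : Type _ :=
  ↥(cocycles 𝒱 B l r) ⧸ (coboundaries 𝒱 B l r).submoduleOf (cocycles 𝒱 B l r)

/-! ### Infinitesimal deformations -/

/-- The coderivation `d_t = l̂ + t φ̂` of `⊙W[t]`. -/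
def defOp (p : ZMod 2) (l φ : Cochain 𝒱) :
    (RSym (rev 𝒱) × RSym (rev 𝒱)) →ₗ[K] (RSym (rev 𝒱) × RSym (rev 𝒱)) :=
  opT p 1 (hat (rev 𝒱) l) (hat (rev 𝒱) φ)

/-- `l + tφ`, with `t` of parity `p`, is an infinitesimal deformation of `l`: an odd
codifferential on `⊙W[t]`. -/
structure IsDeformation (p : ZMod 2) (l φ : Cochain 𝒱) : Prop where
  odd : HasParity (parT p (rPar (rev 𝒱))) (parT p (rPar (rev 𝒱))) 1 (defOp 𝒱 p l φ)
  sq_zero : defOp 𝒱 p l φ ∘ₗ defOp 𝒱 p l φ = 0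

/-- The deformed structure, transferred to `V`: `π⁻¹(l + tφ) = π⁻¹l + (-1)^p t π⁻¹φ`. -/
def defCochain (p : ZMod 2) (l φ : Cochain 𝒱) : RSym (rev 𝒱) →ₗ[K] V × V :=
  LinearMap.prod l (sgn K p • φ)

/-- The inner product, extended to `V[t]`, remains invariant for `l_t = l + tφ`: for the
components `(l_t)ₙ`, which have parity `n`,
`⟨(l_t)ₙ(v₁, …, vₙ), vₙ₊₁⟩ = (-1)^(n + v₁ n) ⟨v₁, (l_t)ₙ(v₂, …, vₙ₊₁)⟩`. -/
def DeformationPreserves (B : LinearMap.BilinForm K V) (p : ZMod 2) (l φ : Cochain 𝒱) : Prop :=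
  ∀ (n : ℕ) (i : Fin (n + 1) → ZMod 2) (v : Fin (n + 1) → V), 1 ≤ n → (∀ k, v k ∈ 𝒱 (i k)) →
    bilT p (parityOp 𝒱) B
        (component 𝒱 (defCochain 𝒱 p l φ) (fun k => i (Fin.castSucc k))
          (fun k => v (Fin.castSucc k)))
        (v (Fin.last n), 0) =
      sgn K ((n : ZMod 2) + i 0 * n) •
        bilT p (parityOp 𝒱) B (v 0, 0)
          (component 𝒱 (defCochain 𝒱 p l φ) (fun k => i (Fin.succ k)) (fun k => v (Fin.succ k)))

/-- The infinitesimal deformations `l + tφ` of `l`, with `t` of parity `p`, that preserve the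
inner product. -/
abbrev Deformation (B : LinearMap.BilinForm K V) (l : Cochain 𝒱) (p : ZMod 2) : Type _ :=
  {φ : Cochain 𝒱 // IsDeformation 𝒱 p l φ ∧ DeformationPreserves 𝒱 B p l φ}

/-- `F` is an automorphism of the coalgebra `⊙W[t]` over `K[t]` (even, `t`-linear, compatible with
the diagonal) that is the identity modulo `t`. Compatibility with the diagonal reads
`Δ(F x) = ∑ F x' ⊗ F x''` in `(⊙W ⊗ ⊙W)[t]`, where `Δ x = ∑ x' ⊗ x''`; by `t`-linearity it is
enough to say so for `x` in `⊙W`. -/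
structure IsCoalgAut (p : ZMod 2)
    (F : (RSym (rev 𝒱) × RSym (rev 𝒱)) ≃ₗ[K] (RSym (rev 𝒱) × RSym (rev 𝒱))) : Prop where
  even : HasParity (parT p (rPar (rev 𝒱))) (parT p (rPar (rev 𝒱))) 0 F.toLinearMap
  t_linear : ∀ z, F (mulT (K := K) z) = mulT (K := K) (F z)
  id_mod_t : ∀ z, (F z).1 = z.1
  diag : ∀ x : RSym (rev 𝒱),
    (rDiag (rev 𝒱) (F (x, 0)).1, rDiag (rev 𝒱) (F (x, 0)).2) =
      TensorProduct.lift
        ((bilT p (rPar (rev 𝒱)) (TensorProduct.mk K (RSym (rev 𝒱)) (RSym (rev 𝒱)))).compl₁₂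
          (F.toLinearMap ∘ₗ LinearMap.inl K _ _) (F.toLinearMap ∘ₗ LinearMap.inl K _ _))
        (rDiag (rev 𝒱) x)

/-- The graded antisymmetric even form `ω(πa, πb) = (-1)^|a| ⟨a, b⟩` on `W`. -/
def omega (B : LinearMap.BilinForm K V) : V →ₗ[K] V →ₗ[K] K := B ∘ₗ parityOp 𝒱

/-- The composite `⊙W → ⊙W[t] → W[t]` of `F` with the projection: the components
`fₙ : ⊙ⁿW → W[t]` of `F`. -/
def autComponents (F : (RSym (rev 𝒱) × RSym (rev 𝒱)) ≃ₗ[K] (RSym (rev 𝒱) × RSym (rev 𝒱))) :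
    RSym (rev 𝒱) →ₗ[K] V × V :=
  LinearMap.prodMap (degOne (rev 𝒱) ∘ₗ incl (rev 𝒱)) (degOne (rev 𝒱) ∘ₗ incl (rev 𝒱)) ∘ₗ
    F.toLinearMap ∘ₗ LinearMap.inl K _ _

/-- A coalgebra automorphism `F` with components `f` preserves the inner product if the form `ω`
is invariant under `F`, regarded as a formal change of coordinates on `W` (`F^* ω = ω`):
for all `x = w₁ ⊙ ⋯ ⊙ wₘ`, `m ≥ 0`, and `u, w` in `W`,
`∑ (-1)^(|u||x''|) ω(f(x' ⊙ u), f(x'' ⊙ w)) = ω(u, w)` if `m = 0`, and `= 0` if `m > 0`,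
where `∑ x' ⊗ x''` is the full coproduct of `x`, including `1 ⊗ x` and `x ⊗ 1`.
If only the linear component `ρ` of `F` is nonzero this says that `⟨ρ v, ρ v'⟩ = ⟨v, v'⟩`. -/
def AutPreserves (B : LinearMap.BilinForm K V) (p : ZMod 2)
    (F : (RSym (rev 𝒱) × RSym (rev 𝒱)) ≃ₗ[K] (RSym (rev 𝒱) × RSym (rev 𝒱))) : Prop :=
  ∀ (x : Sym (rev 𝒱)) (i : ZMod 2) (u w : V), u ∈ rev 𝒱 i →
    TensorProduct.lift
      ((bilT p (parityOp (rev 𝒱)) (omega 𝒱 B)).compl₁₂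
        (autComponents 𝒱 F ∘ₗ red (rev 𝒱) ∘ₗ LinearMap.mulRight K (inc (rev 𝒱) u))
        (autComponents 𝒱 F ∘ₗ red (rev 𝒱) ∘ₗ LinearMap.mulRight K (inc (rev 𝒱) w) ∘ₗ
          tw i (symPar (rev 𝒱)).toLinearMap))
      (coprod (rev 𝒱) x) = (aug (rev 𝒱) x * omega 𝒱 B u w, 0)

/-- Two infinitesimal deformations `l + tφ` and `l + tψ` are equivalent, with the inner product
preserved: an automorphism of the coalgebra `⊙W[t]` that is the identity modulo `t` and preserves
the inner product takes the first codifferential to the second. -/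
def Equivalent (B : LinearMap.BilinForm K V) (p : ZMod 2) (l φ ψ : Cochain 𝒱) : Prop :=
  ∃ F : (RSym (rev 𝒱) × RSym (rev 𝒱)) ≃ₗ[K] (RSym (rev 𝒱) × RSym (rev 𝒱)),
    IsCoalgAut 𝒱 p F ∧ AutPreserves 𝒱 B p F ∧
      F.toLinearMap ∘ₗ defOp 𝒱 p l φ = defOp 𝒱 p l ψ ∘ₗ F.toLinearMap

end Cochains

end LInf

end

open LInf

open scoped TensorProduct

noncomputable section

namespace LInf

/-! ### Signs, and the calculus of homogeneous maps -/

section Signs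

variable {K : Type*} [Field K]

/-! Since `t ^ 2 = 0`, every condition reduces to its coefficient of `t`. The square of `l̂ + tφ̂`
is `t` times `φ̂ l̂ + (-1)^p l̂ φ̂`, which is the coderivation of `D φ`, so deformations are
cocycles of parity `p + 1`. A `t`-linear automorphism that is the identity modulo `t` has the form
`1 + tG`. It respects the diagonal exactly if `G` is a coderivation, that is `G = γ̂` for a cochain
`γ` of parity `p`. It preserves `ω` exactly if `γ` is cyclic, and it carries `l̂ + tφ̂` to `l̂ +
tψ̂` exactly if `D γ = ψ - φ`.

Three facts carry this. First, a coderivation is determined by its component in degree one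
(`IsCoder.eq_coext`), because in characteristic `0` the primitive elements of the symmetric
coalgebra lie in `W`; hence brackets of cochains correspond to commutators of coderivations
(`hat_commutator`). Second, the componentwise cyclicity condition, with all its signs, is equivalent
to the single identity `SymCyclic` on the symmetric algebra (`isCyclicCochain_iff`). Third, that
identity passes to brackets (`SymCyclic.commutator`), so `D` preserves cyclic cochains.

Most arguments run on the full symmetric algebra, by induction on left multiplication by one
homogeneous element, and are then transported to the reduced coalgebra. -/

theorem zmod_two_cases (i : ZMod 2) : i = 0 ∨ i = 1 := by
  revert i; decide

theorem zmod_two_add_self (i : ZMod 2) : i + i = 0 := by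
  revert i; decide

@[simp]
theorem sgn_zero : sgn K 0 = 1 := by simp [sgn]

@[simp]
theorem sgn_one : sgn K 1 = -1 := by simp [sgn]

theorem sgn_add (i j : ZMod 2) : sgn K (i + j) = sgn K i * sgn K j := by
  obtain rfl | rfl := zmod_two_cases i <;> obtain rfl | rfl := zmod_two_cases j <;>
    simp [zmod_two_add_self]

@[simp]
theorem sgn_mul_self (i : ZMod 2) : sgn K i * sgn K i = 1 := by
  rw [← sgn_add, zmod_two_add_self, sgn_zero]

theorem sgn_ne_zero (i : ZMod 2) : sgn K i ≠ 0 := fun h => by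
  simpa [h] using sgn_mul_self (K := K) i

theorem eq_sgn_smul_comm {M : Type*} [AddCommGroup M] [Module K M] {i : ZMod 2} {x y : M}
    (h : x = sgn K i • y) : y = sgn K i • x := by
  rw [h, smul_smul, sgn_mul_self, one_smul]

variable {M N R : Type*} [AddCommGroup M] [Module K M] [AddCommGroup N] [Module K N]
  [AddCommGroup R] [Module K R]

@[simp]
theorem tw_zero (P : M →ₗ[K] M) : tw 0 P = LinearMap.id := by simp [tw]

@[simp]
theorem tw_one (P : M →ₗ[K] M) : tw 1 P = P := by simp [tw]

theorem HasParity.apply {P : M →ₗ[K] M} {Q : N →ₗ[K] N} {r : ZMod 2} {f : M →ₗ[K] N}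
    (h : HasParity P Q r f) (x : M) : Q (f x) = sgn K r • f (P x) :=
  LinearMap.congr_fun h x

theorem HasParity.tw_apply {P : M →ₗ[K] M} {Q : N →ₗ[K] N} {r : ZMod 2} {f : M →ₗ[K] N}
    (h : HasParity P Q r f) (i : ZMod 2) (x : M) :
    tw i Q (f x) = sgn K (i * r) • f (tw i P x) := by
  obtain rfl | rfl := zmod_two_cases i
  · simp
  · simpa using h.apply x

theorem HasParity.comp {P : M →ₗ[K] M} {Q : N →ₗ[K] N} {S : R →ₗ[K] R} {r s : ZMod 2}
    {f : M →ₗ[K] N} {g : N →ₗ[K] R} (hf : HasParity P Q r f) (hg : HasParity Q S s g) :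
    HasParity P S (r + s) (g ∘ₗ f) := by
  refine LinearMap.ext fun x => ?_
  simp [hg.apply, hf.apply, smul_smul, sgn_add, mul_comm]

theorem HasParity.sub {P : M →ₗ[K] M} {Q : N →ₗ[K] N} {r : ZMod 2} {f g : M →ₗ[K] N}
    (hf : HasParity P Q r f) (hg : HasParity P Q r g) : HasParity P Q r (f - g) := by
  refine LinearMap.ext fun x => ?_
  simp [hg.apply, hf.apply, smul_sub]

theorem HasParity.smul {P : M →ₗ[K] M} {Q : N →ₗ[K] N} {r : ZMod 2} {f : M →ₗ[K] N}
    (hf : HasParity P Q r f) (c : K) : HasParity P Q r (c • f) := by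
  refine LinearMap.ext fun x => ?_
  simp [hf.apply, smul_comm c]

theorem tw_tw_self {P : M →ₗ[K] M} (hP : ∀ x, P (P x) = x) (i : ZMod 2) (x : M) :
    tw i P (tw i P x) = x := by
  obtain rfl | rfl := zmod_two_cases i <;> simp [hP]

theorem tw_add {P : M →ₗ[K] M} (hP : ∀ x, P (P x) = x) (i j : ZMod 2) (x : M) :
    tw (i + j) P x = tw i P (tw j P x) := by
  obtain rfl | rfl := zmod_two_cases i <;> obtain rfl | rfl := zmod_two_cases j <;>
    simp [zmod_two_add_self, hP]

end Signs

/-! ### The parity operator of a graded space -/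

section Parity

variable {K : Type*} [Field K] {W : Type*} [AddCommGroup W] [Module K W]
variable (𝒲 : ZMod 2 → Submodule K W) [DirectSum.Decomposition 𝒲]

theorem parityOp_parityOp (w : W) : parityOp 𝒲 (parityOp 𝒲 w) = w := by
  induction w using DirectSum.Decomposition.inductionOn 𝒲 with
  | zero => simp
  | @homogeneous i m =>
    rw [parityOp_of_mem 𝒲 m.2, map_smul, parityOp_of_mem 𝒲 m.2, smul_smul, sgn_mul_self, one_smul]
  | add a b ha hb => rw [map_add, map_add, ha, hb]

theorem tw_parityOp_of_mem {i : ZMod 2} {w : W} (hw : w ∈ 𝒲 i) (j : ZMod 2) :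
    tw j (parityOp 𝒲) w = sgn K (j * i) • w := by
  obtain rfl | rfl := zmod_two_cases j
  · simp
  · simp [parityOp_of_mem 𝒲 hw]

theorem grProj_mem (i : ZMod 2) (w : W) : grProj 𝒲 i w ∈ 𝒲 i := Subtype.mem _

theorem grProj_add_grProj (w : W) : grProj 𝒲 0 w + grProj 𝒲 1 w = w := by
  induction w using DirectSum.Decomposition.inductionOn 𝒲 with
  | zero => simp
  | @homogeneous i m =>
    simp only [grProj_of_mem 𝒲 m.2]
    obtain rfl | rfl := zmod_two_cases i <;> simp
  | add a b ha hb =>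
    nth_rewrite 3 [← ha]
    nth_rewrite 3 [← hb]
    simp only [map_add]
    abel

/-- `HasParity` is phrased with sign operators; this recovers genuine membership in a graded piece,
at the price of dividing by `2`. -/
theorem mem_of_parityOp_eq [CharZero K] {i : ZMod 2} {w : W} (h : parityOp 𝒲 w = sgn K i • w) :
    w ∈ 𝒲 i := by
  have h1 := grProj_add_grProj 𝒲 w
  have h2 : grProj 𝒲 0 w - grProj 𝒲 1 w = sgn K i • w := h
  have h3 : (2 : K) • w = (2 : K) • grProj 𝒲 i w := by
    rw [two_smul, two_smul]
    obtain rfl | rfl := zmod_two_cases i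
    · rw [sgn_zero, one_smul] at h2
      nth_rewrite 1 [← h1]
      nth_rewrite 3 [← h2]
      abel
    · rw [sgn_one, neg_one_smul] at h2
      calc w + w = w - -w := by abel
        _ = (grProj 𝒲 0 w + grProj 𝒲 1 w) - (grProj 𝒲 0 w - grProj 𝒲 1 w) := by rw [h1, h2]
        _ = grProj 𝒲 1 w + grProj 𝒲 1 w := by abel
  rw [smul_right_injective W (two_ne_zero (α := K)) h3]
  exact grProj_mem 𝒲 i w

end Parity

/-! ### Induction, graded commutativity and counits for the symmetric algebra -/

section Symmetric

variable {K : Type*} [Field K] {W : Type*} [AddCommGroup W] [Module K W]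
variable (𝒲 : ZMod 2 → Submodule K W)

@[simp]
theorem aug_inc (w : W) : aug 𝒲 (inc 𝒲 w) = 0 := by simp [aug]

@[simp]
theorem degOne_one : degOne 𝒲 1 = 0 := by simp [degOne]

variable [DirectSum.Decomposition 𝒲]

/-- The inductive step has the shape of the recursion `coprod_inc_mul`, so unshuffles never have to
be written out. -/
theorem sym_induction {p : Sym 𝒲 → Prop} (one : p 1)
    (inc_mul : ∀ (i : ZMod 2) (w : W) (x : Sym 𝒲), w ∈ 𝒲 i → p x → p (inc 𝒲 w * x))
    (add : ∀ x y, p x → p y → p (x + y)) (smul : ∀ (c : K) x, p x → p (c • x))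
    (x : Sym 𝒲) : p x := by
  have zero : p 0 := by simpa using smul 0 1 one
  obtain ⟨t, rfl⟩ : ∃ t, symMk 𝒲 t = x := RingQuot.mkAlgHom_surjective K _ x
  -- Stability of `p` under multiplication by `t`, unlike `p` itself, passes to products in the
  -- tensor algebra.
  have h : ∀ x, p x → p (symMk 𝒲 t * x) := by
    induction t using TensorAlgebra.induction with
    | algebraMap c =>
      intro x hx
      rw [AlgHom.commutes, ← Algebra.smul_def]
      exact smul c x hx
    | ι w =>
      intro x hx
      change p (inc 𝒲 w * x)
      rw [← grProj_add_grProj 𝒲 w, map_add, add_mul]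
      exact add _ _ (inc_mul 0 _ x (grProj_mem 𝒲 0 w) hx) (inc_mul 1 _ x (grProj_mem 𝒲 1 w) hx)
    | mul a b ha hb =>
      intro x hx
      rw [map_mul, mul_assoc]
      exact ha _ (hb _ hx)
    | add a b ha hb =>
      intro x hx
      rw [map_add, add_mul]
      exact add _ _ (ha _ hx) (hb _ hx)
  simpa using h 1 one

theorem sym_ext {N : Type*} [AddCommGroup N] [Module K N] {f g : Sym 𝒲 →ₗ[K] N}
    (one : f 1 = g 1)
    (inc_mul : ∀ (i : ZMod 2) (w : W) (x : Sym 𝒲), w ∈ 𝒲 i → f x = g x →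
      f (inc 𝒲 w * x) = g (inc 𝒲 w * x)) : f = g := by
  refine LinearMap.ext fun x => sym_induction 𝒲 one inc_mul (fun x y hx hy => ?_)
    (fun c x hx => ?_) x
  · rw [map_add, map_add, hx, hy]
  · rw [map_smul, map_smul, hx]

@[simp]
theorem degOne_inc_mul (w : W) (x : Sym 𝒲) : degOne 𝒲 (inc 𝒲 w * x) = aug 𝒲 x • w := by
  have h : ∀ x : Sym 𝒲, (degOneAux 𝒲 x (1, 0)).1 = aug 𝒲 x := by
    intro x
    induction x using sym_induction 𝒲 with
    | one => simp
    | inc_mul i w x hw hx => simp [degOneAux]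
    | add x y hx hy => simp [hx, hy]
    | smul c x hx => simp [hx]
  rw [← h x]
  simp [degOne, degOneAux]

theorem degOne_inc (w : W) : degOne 𝒲 (inc 𝒲 w) = w := by
  simpa using degOne_inc_mul 𝒲 w 1

@[simp]
theorem symPar_inc (w : W) : symPar 𝒲 (inc 𝒲 w) = inc 𝒲 (parityOp 𝒲 w) := by
  simp [symPar]

/-- The operator `x ↦ (-1)^(i|x|) x` on the symmetric algebra. -/
def symTw (i : ZMod 2) : Sym 𝒲 →ₗ[K] Sym 𝒲 := tw i (symPar 𝒲).toLinearMap

theorem symPar_symPar (x : Sym 𝒲) : symPar 𝒲 (symPar 𝒲 x) = x := by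
  induction x using sym_induction 𝒲 with
  | one => simp
  | inc_mul i w x hw hx => rw [map_mul, map_mul, hx, symPar_inc, symPar_inc, parityOp_parityOp]
  | add x y hx hy => rw [map_add, map_add, hx, hy]
  | smul c x hx => rw [map_smul, map_smul, hx]

@[simp]
theorem symTw_symTw_self (i : ZMod 2) (x : Sym 𝒲) : symTw 𝒲 i (symTw 𝒲 i x) = x :=
  tw_tw_self (symPar_symPar 𝒲) i x

theorem symTw_add (i j : ZMod 2) (x : Sym 𝒲) :
    symTw 𝒲 (i + j) x = symTw 𝒲 i (symTw 𝒲 j x) :=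
  tw_add (symPar_symPar 𝒲) i j x

theorem symTw_comm (i j : ZMod 2) (x : Sym 𝒲) :
    symTw 𝒲 i (symTw 𝒲 j x) = symTw 𝒲 j (symTw 𝒲 i x) := by
  rw [← symTw_add, add_comm, symTw_add]

@[simp]
theorem symTw_zero (x : Sym 𝒲) : symTw 𝒲 0 x = x := by simp [symTw]

@[simp]
theorem symTw_one (i : ZMod 2) : symTw 𝒲 i 1 = 1 := by
  obtain rfl | rfl := zmod_two_cases i <;> simp [symTw]

theorem symTw_mul (i : ZMod 2) (x y : Sym 𝒲) :
    symTw 𝒲 i (x * y) = symTw 𝒲 i x * symTw 𝒲 i y := by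
  obtain rfl | rfl := zmod_two_cases i <;> simp [symTw]

theorem symTw_inc (i : ZMod 2) (w : W) :
    symTw 𝒲 i (inc 𝒲 w) = inc 𝒲 (tw i (parityOp 𝒲) w) := by
  obtain rfl | rfl := zmod_two_cases i <;> simp [symTw]

theorem symTw_inc_mul {i : ZMod 2} {w : W} (hw : w ∈ 𝒲 i) (j : ZMod 2) (x : Sym 𝒲) :
    symTw 𝒲 j (inc 𝒲 w * x) = sgn K (j * i) • (inc 𝒲 w * symTw 𝒲 j x) := by
  rw [symTw_mul, symTw_inc, tw_parityOp_of_mem 𝒲 hw, map_smul, smul_mul_assoc]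

@[simp]
theorem aug_symTw (i : ZMod 2) (x : Sym 𝒲) : aug 𝒲 (symTw 𝒲 i x) = aug 𝒲 x := by
  induction x using sym_induction 𝒲 with
  | one => simp
  | inc_mul i w x hw hx => simp [symTw_mul, symTw_inc]
  | add x y hx hy => simp only [map_add, hx, hy]
  | smul c x hx => simp only [map_smul, hx]

/-- Graded commutativity. -/
theorem mul_inc {i : ZMod 2} {w : W} (hw : w ∈ 𝒲 i) (x : Sym 𝒲) :
    x * inc 𝒲 w = inc 𝒲 w * symTw 𝒲 i x := by
  induction x using sym_induction 𝒲 with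
  | one => simp
  | inc_mul j v x hv hx =>
    rw [symTw_inc_mul 𝒲 hv, mul_smul_comm, ← mul_assoc, inc_mul_inc 𝒲 hw hv, smul_mul_assoc,
      smul_smul, sgn_mul_self, one_smul, mul_assoc, hx, mul_assoc]
  | add x y hx hy => rw [add_mul, map_add, mul_add, hx, hy]
  | smul c x hx => rw [smul_mul_assoc, map_smul, mul_smul_comm, hx]

theorem coprod_inc_mul_of_mem {i : ZMod 2} {w : W} (hw : w ∈ 𝒲 i) (x : Sym 𝒲) :
    coprod 𝒲 (inc 𝒲 w * x) =
      (TensorProduct.map (LinearMap.mulLeft K (inc 𝒲 w)) (LinearMap.id (M := Sym 𝒲)) +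
        TensorProduct.map (symTw 𝒲 i) (LinearMap.mulLeft K (inc 𝒲 w)) :
          Sym 𝒲 ⊗[K] Sym 𝒲 →ₗ[K] Sym 𝒲 ⊗[K] Sym 𝒲) (coprod 𝒲 x) := by
  rw [coprod_inc_mul]
  refine LinearMap.congr_fun (TensorProduct.ext' fun a b => ?_) _
  simpa [symTw] using primMul_tmul 𝒲 hw a b

/-- The working form of the recursion for the coproduct: an identity between linear functions of it
need only be checked on pure tensors. -/
theorem map_coprod_inc_mul {N : Type*} [AddCommGroup N] [Module K N]
    (f : Sym 𝒲 ⊗[K] Sym 𝒲 →ₗ[K] N) {i : ZMod 2} {w : W} (hw : w ∈ 𝒲 i) (x : Sym 𝒲)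
    (g : Sym 𝒲 ⊗[K] Sym 𝒲 →ₗ[K] N)
    (h : ∀ a b, f ((inc 𝒲 w * a) ⊗ₜ b) + f (symTw 𝒲 i a ⊗ₜ (inc 𝒲 w * b)) = g (a ⊗ₜ b)) :
    f (coprod 𝒲 (inc 𝒲 w * x)) = g (coprod 𝒲 x) := by
  rw [coprod_inc_mul_of_mem 𝒲 hw, ← LinearMap.comp_apply]
  refine LinearMap.congr_fun (TensorProduct.ext' fun a b => ?_) _
  simpa using h a b

theorem coprod_inc (w : W) : coprod 𝒲 (inc 𝒲 w) = inc 𝒲 w ⊗ₜ 1 + 1 ⊗ₜ inc 𝒲 w := by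
  have key : ∀ i, coprod 𝒲 (inc 𝒲 (grProj 𝒲 i w)) =
      inc 𝒲 (grProj 𝒲 i w) ⊗ₜ 1 + 1 ⊗ₜ inc 𝒲 (grProj 𝒲 i w) := fun i => by
    have h := coprod_inc_mul_of_mem 𝒲 (grProj_mem 𝒲 i w) 1
    simpa [coprod_one] using h
  rw [← grProj_add_grProj 𝒲 w]
  simp only [map_add, key, TensorProduct.add_tmul, TensorProduct.tmul_add]
  abel

theorem counit_right (x : Sym 𝒲) :
    TensorProduct.rid K (Sym 𝒲) (TensorProduct.map LinearMap.id (aug 𝒲).toLinearMap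
      (coprod 𝒲 x)) = x := by
  suffices h : (TensorProduct.rid K (Sym 𝒲)).toLinearMap ∘ₗ
      TensorProduct.map LinearMap.id (aug 𝒲).toLinearMap ∘ₗ coprod 𝒲 = LinearMap.id from
    LinearMap.congr_fun h x
  refine sym_ext 𝒲 (by simp [coprod_one]) fun i w x hw hx => ?_
  simp only [LinearMap.comp_apply, LinearMap.id_apply, LinearEquiv.coe_coe] at hx ⊢
  nth_rewrite 2 [← hx]
  refine map_coprod_inc_mul 𝒲 ((TensorProduct.rid K (Sym 𝒲)).toLinearMap ∘ₗ
      TensorProduct.map LinearMap.id (aug 𝒲).toLinearMap) hw x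
    (LinearMap.mulLeft K (inc 𝒲 w) ∘ₗ (TensorProduct.rid K (Sym 𝒲)).toLinearMap ∘ₗ
      TensorProduct.map LinearMap.id (aug 𝒲).toLinearMap) fun a b => ?_
  simp

theorem counit_left (x : Sym 𝒲) :
    TensorProduct.lid K (Sym 𝒲) (TensorProduct.map (aug 𝒲).toLinearMap LinearMap.id
      (coprod 𝒲 x)) = x := by
  suffices h : (TensorProduct.lid K (Sym 𝒲)).toLinearMap ∘ₗ
      TensorProduct.map (aug 𝒲).toLinearMap LinearMap.id ∘ₗ coprod 𝒲 = LinearMap.id from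
    LinearMap.congr_fun h x
  refine sym_ext 𝒲 (by simp [coprod_one]) fun i w x hw hx => ?_
  simp only [LinearMap.comp_apply, LinearMap.id_apply, LinearEquiv.coe_coe] at hx ⊢
  nth_rewrite 2 [← hx]
  refine map_coprod_inc_mul 𝒲 ((TensorProduct.lid K (Sym 𝒲)).toLinearMap ∘ₗ
      TensorProduct.map (aug 𝒲).toLinearMap LinearMap.id) hw x
    (LinearMap.mulLeft K (inc 𝒲 w) ∘ₗ (TensorProduct.lid K (Sym 𝒲)).toLinearMap ∘ₗ
      TensorProduct.map (aug 𝒲).toLinearMap LinearMap.id) fun a b => ?_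
  simp

end Symmetric

/-! ### Coderivations of the full symmetric coalgebra -/

section Coderivations

variable {K : Type*} [Field K] {W : Type*} [AddCommGroup W] [Module K W]
variable (𝒲 : ZMod 2 → Submodule K W) [DirectSum.Decomposition 𝒲]

/-- A cochain on the full symmetric algebra is homogeneous of parity `r`. -/
abbrev CochainParity (r : ZMod 2) (φ : Sym 𝒲 →ₗ[K] W) : Prop :=
  HasParity (symPar 𝒲).toLinearMap (parityOp 𝒲) r φ

/-- An operator on the full symmetric algebra is homogeneous of parity `r`. -/
abbrev OpParity (r : ZMod 2) (G : Sym 𝒲 →ₗ[K] Sym 𝒲) : Prop :=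
  HasParity (symPar 𝒲).toLinearMap (symPar 𝒲).toLinearMap r G

/-- The coderivation `x ↦ ∑ φ(x') ⊙ x''` of the full symmetric algebra. -/
def coext (φ : Sym 𝒲 →ₗ[K] W) : Sym 𝒲 →ₗ[K] Sym 𝒲 :=
  LinearMap.mul' K (Sym 𝒲) ∘ₗ TensorProduct.map (inc 𝒲 ∘ₗ φ) LinearMap.id ∘ₗ coprod 𝒲

variable {𝒲} {r s i : ZMod 2} {φ ψ : Sym 𝒲 →ₗ[K] W} {G H : Sym 𝒲 →ₗ[K] Sym 𝒲} {w : W}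

/-- The contraction `φ(w ⊙ -)` is a cochain of another parity; this is why the inductions below
generalize over `r` and `φ`. -/
theorem CochainParity.comp_mulLeft (h : CochainParity 𝒲 r φ) (hw : w ∈ 𝒲 i) :
    CochainParity 𝒲 (r + i) (φ ∘ₗ LinearMap.mulLeft K (inc 𝒲 w)) := by
  refine LinearMap.ext fun x => ?_
  simp [h.apply, symPar_inc_mul 𝒲 hw, smul_smul, sgn_add, -symPar_inc, -map_mul]

theorem OpParity.symTw_apply (h : OpParity 𝒲 r G) (j : ZMod 2) (x : Sym 𝒲) :
    symTw 𝒲 j (G x) = sgn K (j * r) • G (symTw 𝒲 j x) :=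
  h.tw_apply j x

theorem cochainParity_degOne : CochainParity 𝒲 0 (degOne 𝒲) := by
  refine sym_ext 𝒲 (by simp) fun i w x hw _ => ?_
  have h := aug_symTw 𝒲 1 x
  simp only [symTw, tw_one] at h
  simp_all

theorem coext_one : coext 𝒲 φ 1 = inc 𝒲 (φ 1) := by
  simp [coext, coprod_one]

/-- In the sum over unshuffles, `w` is either an argument of `φ` or stays outside; in the latter
case it is moved to the front past `φ`, whence the sign. -/
theorem coext_inc_mul (h : CochainParity 𝒲 r φ) (hw : w ∈ 𝒲 i) (x : Sym 𝒲) :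
    coext 𝒲 φ (inc 𝒲 w * x) = coext 𝒲 (φ ∘ₗ LinearMap.mulLeft K (inc 𝒲 w)) x +
      sgn K (i * r) • (inc 𝒲 w * coext 𝒲 φ x) := by
  refine map_coprod_inc_mul 𝒲
    (LinearMap.mul' K (Sym 𝒲) ∘ₗ TensorProduct.map (inc 𝒲 ∘ₗ φ) LinearMap.id) hw x
    (LinearMap.mul' K (Sym 𝒲) ∘ₗ
        TensorProduct.map (inc 𝒲 ∘ₗ φ ∘ₗ LinearMap.mulLeft K (inc 𝒲 w)) LinearMap.id +
      sgn K (i * r) • (LinearMap.mulLeft K (inc 𝒲 w) ∘ₗ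
        LinearMap.mul' K (Sym 𝒲) ∘ₗ TensorProduct.map (inc 𝒲 ∘ₗ φ) LinearMap.id)) fun a b => ?_
  have e : φ (symTw 𝒲 i a) = sgn K (i * r) • tw i (parityOp 𝒲) (φ a) :=
    eq_sgn_smul_comm (h.tw_apply i a)
  simp [e, ← symTw_inc, ← mul_assoc, mul_inc 𝒲 hw]

theorem opParity_coext (h : CochainParity 𝒲 r φ) : OpParity 𝒲 r (coext 𝒲 φ) := by
  refine LinearMap.ext fun x => ?_
  induction x using sym_induction 𝒲 generalizing r φ with
  | one =>
    have := h.apply 1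
    simp_all [coext_one]
  | inc_mul i w x hw ih =>
    have h1 := ih (h.comp_mulLeft hw)
    have h2 := ih h
    simp only [LinearMap.comp_apply, LinearMap.smul_apply, AlgHom.toLinearMap_apply] at h1 h2 ⊢
    rw [coext_inc_mul h hw, map_add, h1, map_smul, symPar_inc_mul 𝒲 hw, h2, symPar_inc_mul 𝒲 hw,
      map_smul, coext_inc_mul h hw, sgn_add]
    simp only [smul_add, smul_smul, mul_smul_comm]
    congr 2
    ring
  | add x y hx hy => rw [map_add, map_add, hx h, hy h]
  | smul c x hx => rw [map_smul, map_smul, hx h]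

/-- The value of a coderivation on a product whose last factor is `w`. -/
theorem coext_mul_inc (h : CochainParity 𝒲 r φ) (w : W) (x : Sym 𝒲) :
    coext 𝒲 φ (x * inc 𝒲 w) = coext 𝒲 φ x * inc 𝒲 w + LinearMap.mul' K (Sym 𝒲)
      (TensorProduct.map (symTw 𝒲 r) (inc 𝒲 ∘ₗ φ ∘ₗ LinearMap.mulRight K (inc 𝒲 w))
        (coprod 𝒲 x)) := by
  induction x using sym_induction 𝒲 generalizing r φ with
  | one => simp [coext, coprod_one, coprod_inc, add_comm]
  | inc_mul i v x hv ih =>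
    rw [mul_assoc, coext_inc_mul h hv, ih h, ih (h.comp_mulLeft hv), coext_inc_mul h hv]
    have e := map_coprod_inc_mul 𝒲
      (LinearMap.mul' K (Sym 𝒲) ∘ₗ
        TensorProduct.map (symTw 𝒲 r) (inc 𝒲 ∘ₗ φ ∘ₗ LinearMap.mulRight K (inc 𝒲 w))) hv x
      (LinearMap.mul' K (Sym 𝒲) ∘ₗ TensorProduct.map (symTw 𝒲 (r + i)) (inc 𝒲 ∘ₗ
          (φ ∘ₗ LinearMap.mulLeft K (inc 𝒲 v)) ∘ₗ LinearMap.mulRight K (inc 𝒲 w)) +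
        sgn K (i * r) • (LinearMap.mulLeft K (inc 𝒲 v) ∘ₗ LinearMap.mul' K (Sym 𝒲) ∘ₗ
          TensorProduct.map (symTw 𝒲 r) (inc 𝒲 ∘ₗ φ ∘ₗ LinearMap.mulRight K (inc 𝒲 w))))
      fun a b => by
        simp [symTw_inc_mul 𝒲 hv, symTw_add, symTw_comm 𝒲 i r, mul_assoc, mul_comm r i, add_comm]
    simp only [LinearMap.comp_apply, LinearMap.add_apply, LinearMap.smul_apply,
      LinearMap.mulLeft_apply] at e
    rw [e, mul_add, add_mul, smul_add, smul_mul_assoc, mul_assoc]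
    abel
  | add x y hx hy =>
    rw [add_mul, map_add, hx h, hy h]
    simp only [map_add, add_mul]
    abel
  | smul c x hx =>
    rw [smul_mul_assoc, map_smul, hx h]
    simp only [map_smul, smul_mul_assoc, smul_add]

theorem aug_coext (φ : Sym 𝒲 →ₗ[K] W) (x : Sym 𝒲) : aug 𝒲 (coext 𝒲 φ x) = 0 := by
  suffices h : (aug 𝒲).toLinearMap ∘ₗ LinearMap.mul' K (Sym 𝒲) ∘ₗ
      TensorProduct.map (inc 𝒲 ∘ₗ φ) LinearMap.id = 0 from LinearMap.congr_fun h (coprod 𝒲 x)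
  exact TensorProduct.ext' fun a b => by simp

/-- In degree one only terms with scalar `x''` survive, and the counit sums these to `φ x`. -/
theorem degOne_coext (φ : Sym 𝒲 →ₗ[K] W) (x : Sym 𝒲) : degOne 𝒲 (coext 𝒲 φ x) = φ x := by
  have h : degOne 𝒲 ∘ₗ LinearMap.mul' K (Sym 𝒲) ∘ₗ
      TensorProduct.map (inc 𝒲 ∘ₗ φ) LinearMap.id = φ ∘ₗ
        (TensorProduct.rid K (Sym 𝒲)).toLinearMap ∘ₗ
          TensorProduct.map LinearMap.id (aug 𝒲).toLinearMap :=
    TensorProduct.ext' fun a b => by simp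
  nth_rewrite 2 [← counit_right 𝒲 x]
  exact LinearMap.congr_fun h (coprod 𝒲 x)

variable (𝒲) in
/-- The operator `G ⊗ 1 + 1 ⊗ G` on `Sym ⊗ Sym`, with the Koszul sign rule for `G` of
parity `r`. -/
def leibniz (r : ZMod 2) (G : Sym 𝒲 →ₗ[K] Sym 𝒲) : Sym 𝒲 ⊗[K] Sym 𝒲 →ₗ[K] Sym 𝒲 ⊗[K] Sym 𝒲 :=
  TensorProduct.map G LinearMap.id + TensorProduct.map (symTw 𝒲 r) G

@[simp]
theorem leibniz_tmul (r : ZMod 2) (G : Sym 𝒲 →ₗ[K] Sym 𝒲) (a b : Sym 𝒲) :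
    leibniz 𝒲 r G (a ⊗ₜ b) = G a ⊗ₜ b + symTw 𝒲 r a ⊗ₜ G b := by
  simp [leibniz]

variable (𝒲) in
/-- `G` is a coderivation of parity `r` of the full symmetric coalgebra. -/
def IsCoder (r : ZMod 2) (G : Sym 𝒲 →ₗ[K] Sym 𝒲) : Prop :=
  ∀ x, coprod 𝒲 (G x) = leibniz 𝒲 r G (coprod 𝒲 x)

/-- Here `H` is the graded commutator of `G` with multiplication by `w`. Passing to the tensor
square respects this commutator, which drives the induction both for constructing coderivations and
for their uniqueness. -/
theorem leibniz_primMul (hG : OpParity 𝒲 r G) (hw : w ∈ 𝒲 i) (H : Sym 𝒲 →ₗ[K] Sym 𝒲)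
    (hH : ∀ x, G (inc 𝒲 w * x) = H x + sgn K (i * r) • (inc 𝒲 w * G x))
    (z : Sym 𝒲 ⊗[K] Sym 𝒲) :
    leibniz 𝒲 r G (primMul 𝒲 w z) =
      leibniz 𝒲 (r + i) H z + sgn K (i * r) • primMul 𝒲 w (leibniz 𝒲 r G z) := by
  refine LinearMap.congr_fun (f := leibniz 𝒲 r G ∘ₗ primMul 𝒲 w)
    (g := leibniz 𝒲 (r + i) H + sgn K (i * r) • (primMul 𝒲 w ∘ₗ leibniz 𝒲 r G))
    (TensorProduct.ext' fun a b => ?_) z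
  have hp : ∀ a b, primMul 𝒲 w (a ⊗ₜ[K] b) =
      (inc 𝒲 w * a) ⊗ₜ b + symTw 𝒲 i a ⊗ₜ (inc 𝒲 w * b) := primMul_tmul 𝒲 hw
  simp only [LinearMap.comp_apply, LinearMap.add_apply, LinearMap.smul_apply, hp, leibniz_tmul,
    map_add, hH, symTw_inc_mul 𝒲 hw, hG.symTw_apply, TensorProduct.add_tmul,
    TensorProduct.tmul_add, TensorProduct.tmul_smul, ← TensorProduct.smul_tmul', smul_add,
    smul_smul, sgn_mul_self, one_smul, mul_comm r i, symTw_add, symTw_comm 𝒲 i r]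
  abel

theorem isCoder_coext (h : CochainParity 𝒲 r φ) : IsCoder 𝒲 r (coext 𝒲 φ) := by
  intro x
  induction x using sym_induction 𝒲 generalizing r φ with
  | one =>
    rw [coext_one, coprod_inc, coprod_one, leibniz_tmul, symTw_one, coext_one]
  | inc_mul i w x hw ih =>
    rw [coext_inc_mul h hw, map_add, map_smul, coprod_inc_mul, ih h, ih (h.comp_mulLeft hw),
      coprod_inc_mul, leibniz_primMul (opParity_coext h) hw _ (coext_inc_mul h hw)]
  | add x y hx hy => simp only [map_add, hx h, hy h]
  | smul c x hx => simp only [map_smul, hx h]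

/-- The Euler operator, which multiplies a product of `n` elements of `W` by `n`. -/
def euler (𝒲 : ZMod 2 → Submodule K W) [DirectSum.Decomposition 𝒲] : Module.End K (Sym 𝒲) :=
  coext 𝒲 (degOne 𝒲)

theorem euler_inc_mul (w : W) (x : Sym 𝒲) :
    euler 𝒲 (inc 𝒲 w * x) = inc 𝒲 w * x + inc 𝒲 w * euler 𝒲 x := by
  have key : ∀ {i : ZMod 2} {w : W}, w ∈ 𝒲 i →
      euler 𝒲 (inc 𝒲 w * x) = inc 𝒲 w * x + inc 𝒲 w * euler 𝒲 x := by
    intro i w hw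
    -- As `degOne (w ⊙ a) = aug a • w`, the terms in which `w` is contracted collapse to `w ⊙ x` by
    -- the counit.
    have e : LinearMap.mul' K (Sym 𝒲) ∘ₗ
        TensorProduct.map (inc 𝒲 ∘ₗ degOne 𝒲 ∘ₗ LinearMap.mulLeft K (inc 𝒲 w)) LinearMap.id =
        LinearMap.mulLeft K (inc 𝒲 w) ∘ₗ (TensorProduct.lid K (Sym 𝒲)).toLinearMap ∘ₗ
          TensorProduct.map (aug 𝒲).toLinearMap LinearMap.id :=
      TensorProduct.ext' fun a b => by simp
    rw [euler, coext_inc_mul cochainParity_degOne hw]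
    nth_rewrite 3 [← counit_left 𝒲 x]
    congr 1
    · exact LinearMap.congr_fun e (coprod 𝒲 x)
    · simp
  rw [← grProj_add_grProj 𝒲 w]
  simp only [map_add, add_mul, key (grProj_mem 𝒲 _ w)]
  abel

/-- The operator `(E - 1) ⋯ (E - n)`. -/
def eulerProd (𝒲 : ZMod 2 → Submodule K W) [DirectSum.Decomposition 𝒲] : ℕ → Module.End K (Sym 𝒲)
  | 0 => 1
  | n + 1 => (euler 𝒲 - ((n + 1 : ℕ) : K) • 1) * eulerProd 𝒲 n

theorem eulerProd_mono {m n : ℕ} (hmn : m ≤ n) {x : Sym 𝒲} (h : eulerProd 𝒲 m x = 0) :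
    eulerProd 𝒲 n x = 0 := by
  induction n, hmn using Nat.le_induction with
  | base => exact h
  | succ n _ ih => rw [eulerProd, Module.End.mul_apply, ih, map_zero]

theorem eulerProd_euler (n : ℕ) (x : Sym 𝒲) :
    eulerProd 𝒲 n (euler 𝒲 x) = euler 𝒲 (eulerProd 𝒲 n x) := by
  induction n with
  | zero => rfl
  | succ n ih => simp [eulerProd, ih]

/-- With `E` the Euler operator, `E w = w (E + 1)` shifts each factor: `(E - 1) ⋯ (E - n - 1)`
becomes `E (E - 1) ⋯ (E - n)` behind `w`. -/
theorem eulerProd_inc_mul (n : ℕ) (w : W) (x : Sym 𝒲) :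
    eulerProd 𝒲 (n + 1) (inc 𝒲 w * x) = inc 𝒲 w * eulerProd 𝒲 n (euler 𝒲 x) := by
  induction n with
  | zero => simp [eulerProd, euler_inc_mul]
  | succ n ih =>
    rw [eulerProd, Module.End.mul_apply, ih, eulerProd]
    simp only [LinearMap.sub_apply, LinearMap.add_apply, euler_inc_mul, LinearMap.smul_apply,
      Module.End.one_apply, Module.End.mul_apply, mul_sub, mul_add, mul_smul_comm, Nat.cast_succ,
      add_smul, one_smul]
    abel

theorem euler_one : euler 𝒲 1 = 0 := by simp [euler, coext_one]

/-- An element without constant term has parts in finitely many degrees `1, …, n` only. Annihilation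
by an Euler product expresses this without a direct sum decomposition of `Sym`. -/
theorem exists_eulerProd_eq_zero (x : Sym 𝒲) :
    ∃ n, eulerProd 𝒲 n (x - algebraMap K (Sym 𝒲) (aug 𝒲 x)) = 0 := by
  induction x using sym_induction 𝒲 with
  | one => exact ⟨0, by simp⟩
  | inc_mul i w x hw ih =>
    obtain ⟨n, hn⟩ := ih
    refine ⟨n + 1, ?_⟩
    have e : euler 𝒲 x = euler 𝒲 (x - algebraMap K (Sym 𝒲) (aug 𝒲 x)) := by
      rw [map_sub, Algebra.algebraMap_eq_smul_one, map_smul, euler_one, smul_zero, sub_zero]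
    rw [map_mul, aug_inc, zero_mul, map_zero, sub_zero, eulerProd_inc_mul, e, eulerProd_euler, hn,
      map_zero, mul_zero]
  | add x y hx hy =>
    obtain ⟨m, hm⟩ := hx
    obtain ⟨n, hn⟩ := hy
    refine ⟨max m n, ?_⟩
    rw [map_add, map_add, add_sub_add_comm, map_add, eulerProd_mono (le_max_left m n) hm,
      eulerProd_mono (le_max_right m n) hn, add_zero]
  | smul c x hx =>
    obtain ⟨n, hn⟩ := hx
    refine ⟨n, ?_⟩
    have e : c • x - algebraMap K (Sym 𝒲) (aug 𝒲 (c • x)) =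
        c • (x - algebraMap K (Sym 𝒲) (aug 𝒲 x)) := by
      simp [Algebra.algebraMap_eq_smul_one, smul_sub, smul_smul]
    rw [e, map_smul, hn, smul_zero]

/-- On the kernel of the Euler operator the product acts as `(-1)^n n!`, which is invertible in
characteristic `0`, yet for large `n` it kills `x`. Constants are excluded because the operator
kills them too. -/
theorem eq_zero_of_euler_eq_zero [CharZero K] {x : Sym 𝒲} (h0 : aug 𝒲 x = 0)
    (h : euler 𝒲 x = 0) : x = 0 := by
  have key : ∀ n, ∃ c : K, c ≠ 0 ∧ eulerProd 𝒲 n x = c • x := by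
    intro n
    induction n with
    | zero => exact ⟨1, one_ne_zero, by simp [eulerProd]⟩
    | succ n ih =>
      obtain ⟨c, hc, e⟩ := ih
      refine ⟨-((n + 1 : ℕ) : K) * c, mul_ne_zero (neg_ne_zero.2 (Nat.cast_ne_zero.2
        n.succ_ne_zero)) hc, ?_⟩
      rw [eulerProd, Module.End.mul_apply, e]
      simp only [LinearMap.sub_apply, LinearMap.smul_apply, Module.End.one_apply, map_smul, h,
        zero_sub, neg_mul, neg_smul]
      rw [smul_neg, smul_smul, mul_comm]
  obtain ⟨n, hn⟩ := exists_eulerProd_eq_zero x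
  obtain ⟨c, hc, e⟩ := key n
  rw [h0, map_zero, sub_zero, e] at hn
  exact (smul_eq_zero.1 hn).resolve_left hc

/-- On a primitive element the sum `∑ degOne(x') ⊙ x''` is just `degOne x`, so `x` and its degree
one part have the same image under the Euler operator. -/
theorem eq_inc_degOne_of_primitive [CharZero K] {x : Sym 𝒲} (h0 : aug 𝒲 x = 0)
    (h : coprod 𝒲 x = x ⊗ₜ 1 + 1 ⊗ₜ x) : x = inc 𝒲 (degOne 𝒲 x) := by
  have e : euler 𝒲 x = inc 𝒲 (degOne 𝒲 x) := by
    simp [euler, coext, h]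
  have e' : euler 𝒲 (inc 𝒲 (degOne 𝒲 x)) = inc 𝒲 (degOne 𝒲 x) := by
    simpa [euler_one] using euler_inc_mul (𝒲 := 𝒲) (degOne 𝒲 x) 1
  refine sub_eq_zero.1 (eq_zero_of_euler_eq_zero ?_ ?_)
  · simp [h0]
  · rw [map_sub, e, e', sub_self]

/-- A coderivation is determined by its component in degree one. -/
theorem IsCoder.eq_coext [CharZero K] (hp : OpParity 𝒲 r G) (h : IsCoder 𝒲 r G)
    (h0 : ∀ x, aug 𝒲 (G x) = 0) : G = coext 𝒲 (degOne 𝒲 ∘ₗ G) := by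
  refine LinearMap.ext fun x => ?_
  induction x using sym_induction 𝒲 generalizing r G with
  | one =>
    rw [coext_one]
    -- Since `1` is group-like, `G 1` is primitive.
    refine eq_inc_degOne_of_primitive (h0 1) ?_
    rw [h, coprod_one, leibniz_tmul, symTw_one]
  | inc_mul i w x hw ih =>
    -- The commutator with multiplication by `w` is again a coderivation without constant term, of
    -- parity `r + i`, so the induction hypothesis applies to it as well as to `G`.
    let H : Sym 𝒲 →ₗ[K] Sym 𝒲 := G ∘ₗ LinearMap.mulLeft K (inc 𝒲 w) -
      sgn K (i * r) • (LinearMap.mulLeft K (inc 𝒲 w) ∘ₗ G)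
    have hH : ∀ x, G (inc 𝒲 w * x) = H x + sgn K (i * r) • (inc 𝒲 w * G x) := fun x => by
      simp [H]
    have pH : OpParity 𝒲 (r + i) H := by
      refine LinearMap.ext fun x => ?_
      have e := hp.apply
      simp only [AlgHom.toLinearMap_apply] at e
      simp only [H, LinearMap.comp_apply, LinearMap.sub_apply, LinearMap.smul_apply, map_sub,
        map_smul, AlgHom.toLinearMap_apply, LinearMap.mulLeft_apply, e,
        symPar_inc_mul 𝒲 hw, mul_smul_comm, sgn_add, smul_sub, smul_smul]
      congr 2
      ring
    have cH : IsCoder 𝒲 (r + i) H := fun x => by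
      have e := h (inc 𝒲 w * x)
      rw [hH, map_add, map_smul, coprod_inc_mul, coprod_inc_mul, h,
        leibniz_primMul hp hw H hH] at e
      exact add_right_cancel e
    have aH : ∀ x, aug 𝒲 (H x) = 0 := fun x => by simp [H, h0]
    have dH : degOne 𝒲 ∘ₗ H = (degOne 𝒲 ∘ₗ G) ∘ₗ LinearMap.mulLeft K (inc 𝒲 w) := by
      refine LinearMap.ext fun x => ?_
      simp [H, h0]
    have pd : CochainParity 𝒲 r (degOne 𝒲 ∘ₗ G) := by
      simpa using hp.comp cochainParity_degOne
    rw [hH, coext_inc_mul pd hw, ← ih hp h h0, ih pH cH aH, dH]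
  | add x y hx hy => rw [map_add, map_add, ← hx hp h h0, ← hy hp h h0]
  | smul c x hx => rw [map_smul, map_smul, ← hx hp h h0]

/-- The graded commutator of coderivations is a coderivation. -/
theorem IsCoder.commutator (pG : OpParity 𝒲 r G) (pH : OpParity 𝒲 s H) (hG : IsCoder 𝒲 r G)
    (hH : IsCoder 𝒲 s H) : IsCoder 𝒲 (r + s) (G ∘ₗ H - sgn K (r * s) • (H ∘ₗ G)) := by
  intro x
  have e : leibniz 𝒲 r G ∘ₗ leibniz 𝒲 s H - sgn K (r * s) • (leibniz 𝒲 s H ∘ₗ leibniz 𝒲 r G) =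
      leibniz 𝒲 (r + s) (G ∘ₗ H - sgn K (r * s) • (H ∘ₗ G)) := by
    refine TensorProduct.ext' fun a b => ?_
    simp only [LinearMap.comp_apply, LinearMap.sub_apply, LinearMap.smul_apply, leibniz_tmul,
      map_add, pG.symTw_apply, pH.symTw_apply, ← TensorProduct.smul_tmul', smul_add, smul_smul,
      symTw_add, symTw_comm 𝒲 s r, TensorProduct.sub_tmul, TensorProduct.tmul_sub, TensorProduct.tmul_smul,
      mul_comm s r, sgn_mul_self, one_smul]
    abel
  rw [← e]
  simp [hG (H x), hH (G x), hG x, hH x]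

/-- The left side is a coderivation, so only its degree one component has to be computed. -/
theorem coext_commutator [CharZero K] (hφ : CochainParity 𝒲 r φ) (hψ : CochainParity 𝒲 s ψ) :
    coext 𝒲 φ ∘ₗ coext 𝒲 ψ - sgn K (r * s) • (coext 𝒲 ψ ∘ₗ coext 𝒲 φ) =
      coext 𝒲 (φ ∘ₗ coext 𝒲 ψ - sgn K (r * s) • (ψ ∘ₗ coext 𝒲 φ)) := by
  have pφ := opParity_coext hφ
  have pψ := opParity_coext hψ
  have e := IsCoder.eq_coext (r := r + s) (G := coext 𝒲 φ ∘ₗ coext 𝒲 ψ -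
    sgn K (r * s) • (coext 𝒲 ψ ∘ₗ coext 𝒲 φ))
    ((add_comm s r ▸ pψ.comp pφ).sub ((pφ.comp pψ).smul _))
    ((isCoder_coext hφ).commutator pφ pψ (isCoder_coext hψ)) (fun x => by simp [aug_coext])
  rw [e]
  congr 1
  refine LinearMap.ext fun x => ?_
  simp [degOne_coext]

end Coderivations

/-! ### Transport to the reduced coalgebra -/

section Reduced

variable {K : Type*} [Field K] {W : Type*} [AddCommGroup W] [Module K W]
variable (𝒲 : ZMod 2 → Submodule K W)

@[simp]
theorem red_incl (x : RSym 𝒲) : red 𝒲 (incl 𝒲 x) = x := by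
  have h : aug 𝒲 (incl 𝒲 x) = 0 := x.2
  refine Subtype.ext ?_
  change incl 𝒲 x - algebraMap K (Sym 𝒲) (aug 𝒲 (incl 𝒲 x)) = incl 𝒲 x
  rw [h, map_zero, sub_zero]

theorem incl_red (x : Sym 𝒲) : incl 𝒲 (red 𝒲 x) = x - aug 𝒲 x • 1 := by
  rw [← Algebra.algebraMap_eq_smul_one]
  rfl

@[simp]
theorem aug_incl (x : RSym 𝒲) : aug 𝒲 (incl 𝒲 x) = 0 := x.2

theorem incl_red_of_aug_eq_zero {x : Sym 𝒲} (h : aug 𝒲 x = 0) : incl 𝒲 (red 𝒲 x) = x := by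
  rw [incl_red, h, zero_smul, sub_zero]

theorem eq_smul_one_add_incl (x : Sym 𝒲) : x = aug 𝒲 x • 1 + incl 𝒲 (red 𝒲 x) := by
  rw [incl_red]
  abel

@[simp]
theorem red_one : red 𝒲 1 = 0 := by
  refine Subtype.ext ?_
  change incl 𝒲 (red 𝒲 1) = 0
  simp [incl_red]

theorem incl_injective : Function.Injective (incl 𝒲) := Subtype.val_injective

@[simp]
theorem degOne_incl_red (x : Sym 𝒲) : degOne 𝒲 (incl 𝒲 (red 𝒲 x)) = degOne 𝒲 x := by
  simp [incl_red]

variable [DirectSum.Decomposition 𝒲]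

theorem red_symPar (x : Sym 𝒲) : red 𝒲 (symPar 𝒲 x) = rPar 𝒲 (red 𝒲 x) := by
  simp [rPar, incl_red]

theorem incl_rPar (x : RSym 𝒲) : incl 𝒲 (rPar 𝒲 x) = symPar 𝒲 (incl 𝒲 x) := by
  have h := aug_symTw 𝒲 1 (incl 𝒲 x)
  rw [aug_incl] at h
  refine incl_red_of_aug_eq_zero 𝒲 ?_
  simpa [symTw] using h

theorem red_symTw (i : ZMod 2) (x : Sym 𝒲) :
    red 𝒲 (symTw 𝒲 i x) = tw i (rPar 𝒲) (red 𝒲 x) := by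
  obtain rfl | rfl := zmod_two_cases i
  · simp
  · simp [symTw, red_symPar]

theorem incl_tw_rPar (i : ZMod 2) (x : RSym 𝒲) :
    incl 𝒲 (tw i (rPar 𝒲) x) = symTw 𝒲 i (incl 𝒲 x) := by
  obtain rfl | rfl := zmod_two_cases i
  · simp
  · simp [symTw, incl_rPar]

variable {𝒲} {r s : ZMod 2} {φ ψ : RSym 𝒲 →ₗ[K] W}

theorem cochainParity_comp_red (h : HasParity (rPar 𝒲) (parityOp 𝒲) r φ) :
    CochainParity 𝒲 r (φ ∘ₗ red 𝒲) := by
  refine LinearMap.ext fun x => ?_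
  simp [h.apply, red_symPar]

theorem incl_hat (φ : RSym 𝒲 →ₗ[K] W) (x : RSym 𝒲) :
    incl 𝒲 (hat 𝒲 φ x) = coext 𝒲 (φ ∘ₗ red 𝒲) (incl 𝒲 x) :=
  incl_red_of_aug_eq_zero 𝒲 (aug_coext (φ ∘ₗ red 𝒲) (incl 𝒲 x))

theorem red_coext (φ : RSym 𝒲 →ₗ[K] W) (x : Sym 𝒲) :
    red 𝒲 (coext 𝒲 (φ ∘ₗ red 𝒲) x) = hat 𝒲 φ (red 𝒲 x) := by
  nth_rewrite 1 [eq_smul_one_add_incl 𝒲 x]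
  rw [map_add, map_smul, coext_one, ← incl_hat]
  simp

@[simp]
theorem degOne_incl_hat (φ : RSym 𝒲 →ₗ[K] W) (x : RSym 𝒲) :
    degOne 𝒲 (incl 𝒲 (hat 𝒲 φ x)) = φ x := by
  rw [incl_hat, degOne_coext, LinearMap.comp_apply, red_incl]

theorem hat_injective : Function.Injective (hat 𝒲) := fun φ ψ h => by
  refine LinearMap.ext fun x => ?_
  rw [← degOne_incl_hat φ x, h, degOne_incl_hat]

theorem hasParity_degOne_incl :
    HasParity (rPar 𝒲) (parityOp 𝒲) 0 (degOne 𝒲 ∘ₗ incl 𝒲) := by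
  refine LinearMap.ext fun x => ?_
  have h := (cochainParity_degOne (𝒲 := 𝒲)).apply (incl 𝒲 x)
  simpa [incl_rPar] using h

theorem hasParity_hat (h : HasParity (rPar 𝒲) (parityOp 𝒲) r φ) :
    HasParity (rPar 𝒲) (rPar 𝒲) r (hat 𝒲 φ) := by
  refine LinearMap.ext fun x => incl_injective 𝒲 ?_
  have e := (opParity_coext (cochainParity_comp_red h)).apply (incl 𝒲 x)
  change incl 𝒲 (rPar 𝒲 (hat 𝒲 φ x)) = incl 𝒲 (sgn K r • hat 𝒲 φ (rPar 𝒲 x))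
  rw [incl_rPar, map_smul, incl_hat, incl_hat, incl_rPar]
  exact e

theorem hasParity_of_hat (h : HasParity (rPar 𝒲) (rPar 𝒲) r (hat 𝒲 φ)) :
    HasParity (rPar 𝒲) (parityOp 𝒲) r φ := by
  have e : φ = (degOne 𝒲 ∘ₗ incl 𝒲) ∘ₗ hat 𝒲 φ := LinearMap.ext fun x => by simp
  rw [e]
  simpa using h.comp hasParity_degOne_incl

/-- The bracket of cochains, on cochains of parities `r` and `s`. -/
theorem hat_commutator [CharZero K] (hφ : HasParity (rPar 𝒲) (parityOp 𝒲) r φ)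
    (hψ : HasParity (rPar 𝒲) (parityOp 𝒲) s ψ) :
    hat 𝒲 φ ∘ₗ hat 𝒲 ψ - sgn K (r * s) • (hat 𝒲 ψ ∘ₗ hat 𝒲 φ) =
      hat 𝒲 (φ ∘ₗ hat 𝒲 ψ - sgn K (r * s) • (ψ ∘ₗ hat 𝒲 φ)) := by
  have e := coext_commutator (cochainParity_comp_red hφ) (cochainParity_comp_red hψ)
  have e' : (φ ∘ₗ hat 𝒲 ψ - sgn K (r * s) • (ψ ∘ₗ hat 𝒲 φ)) ∘ₗ red 𝒲 =
      (φ ∘ₗ red 𝒲) ∘ₗ coext 𝒲 (ψ ∘ₗ red 𝒲) -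
        sgn K (r * s) • ((ψ ∘ₗ red 𝒲) ∘ₗ coext 𝒲 (φ ∘ₗ red 𝒲)) :=
    LinearMap.ext fun x => by simp [red_coext]
  refine LinearMap.ext fun x => incl_injective 𝒲 ?_
  rw [incl_hat, e', ← e]
  simp [incl_hat]

theorem coprod_incl (x : RSym 𝒲) : coprod 𝒲 (incl 𝒲 x) = incl 𝒲 x ⊗ₜ 1 + 1 ⊗ₜ incl 𝒲 x +
    TensorProduct.map (incl 𝒲) (incl 𝒲) (rDiag 𝒲 x) := by
  -- Splitting both tensor factors as `K ⊕ RSym`: the scalar part `1 ⊗ 1` occurs in both of the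
  -- first two terms and is subtracted once.
  have h1 : ∀ z : Sym 𝒲 ⊗[K] Sym 𝒲, z = TensorProduct.rid K (Sym 𝒲)
      (TensorProduct.map LinearMap.id (aug 𝒲).toLinearMap z) ⊗ₜ 1 +
      1 ⊗ₜ TensorProduct.lid K (Sym 𝒲)
        (TensorProduct.map (aug 𝒲).toLinearMap LinearMap.id z) -
      aug 𝒲 (TensorProduct.rid K (Sym 𝒲)
        (TensorProduct.map LinearMap.id (aug 𝒲).toLinearMap z)) • 1 ⊗ₜ 1 +
      TensorProduct.map (incl 𝒲) (incl 𝒲) (TensorProduct.map (red 𝒲) (red 𝒲) z) := by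
    intro z
    induction z using TensorProduct.induction_on with
    | zero => simp
    | tmul a b =>
      simp only [TensorProduct.map_tmul, LinearMap.id_apply, AlgHom.toLinearMap_apply,
        TensorProduct.rid_tmul, TensorProduct.lid_tmul, incl_red, TensorProduct.sub_tmul,
        TensorProduct.tmul_sub, ← TensorProduct.smul_tmul', TensorProduct.tmul_smul, map_smul,
        smul_sub, smul_smul, smul_eq_mul, mul_comm]
      abel
    | add a b ha hb =>
      nth_rewrite 1 [ha, hb]
      simp only [map_add, TensorProduct.add_tmul, TensorProduct.tmul_add, add_smul]
      abel
  have h2 := h1 (coprod 𝒲 (incl 𝒲 x))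
  rw [counit_left, counit_right, aug_incl, zero_smul, sub_zero] at h2
  exact h2

variable (𝒲) in
/-- The operator `G ⊗ 1 + 1 ⊗ G` on the square of the reduced symmetric coalgebra, with the Koszul
sign rule for `G` of parity `p`. -/
def rLeibniz (p : ZMod 2) (G : RSym 𝒲 →ₗ[K] RSym 𝒲) :
    RSym 𝒲 ⊗[K] RSym 𝒲 →ₗ[K] RSym 𝒲 ⊗[K] RSym 𝒲 :=
  TensorProduct.map G LinearMap.id + TensorProduct.map (tw p (rPar 𝒲)) G

theorem rDiag_hat (h : HasParity (rPar 𝒲) (parityOp 𝒲) r φ) (x : RSym 𝒲) :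
    rDiag 𝒲 (hat 𝒲 φ x) = rLeibniz 𝒲 r (hat 𝒲 φ) (rDiag 𝒲 x) := by
  have e : TensorProduct.map (red 𝒲) (red 𝒲) ∘ₗ leibniz 𝒲 r (coext 𝒲 (φ ∘ₗ red 𝒲)) =
      rLeibniz 𝒲 r (hat 𝒲 φ) ∘ₗ TensorProduct.map (red 𝒲) (red 𝒲) :=
    TensorProduct.ext' fun a b => by simp [rLeibniz, red_coext, red_symTw]
  simp only [rDiag, LinearMap.comp_apply]
  rw [incl_hat, isCoder_coext (cochainParity_comp_red h)]
  exact LinearMap.congr_fun e _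

/-- Extended by `0` on scalars, `G` becomes a coderivation of the full coalgebra, where uniqueness
is known. -/
theorem eq_hat_of_rDiag [CharZero K] {G : RSym 𝒲 →ₗ[K] RSym 𝒲}
    (hp : HasParity (rPar 𝒲) (rPar 𝒲) r G)
    (h : ∀ x, rDiag 𝒲 (G x) = rLeibniz 𝒲 r G (rDiag 𝒲 x)) :
    G = hat 𝒲 (degOne 𝒲 ∘ₗ incl 𝒲 ∘ₗ G) := by
  let H : Sym 𝒲 →ₗ[K] Sym 𝒲 := incl 𝒲 ∘ₗ G ∘ₗ red 𝒲
  have H_one : H 1 = 0 := by simp [H]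
  have H_incl : ∀ x, H (incl 𝒲 x) = incl 𝒲 (G x) := fun x => by simp [H]
  have pH : OpParity 𝒲 r H := LinearMap.ext fun x => by
    simp [H, ← incl_rPar, red_symPar, hp.apply]
  have e : leibniz 𝒲 r H ∘ₗ TensorProduct.map (incl 𝒲) (incl 𝒲) =
      TensorProduct.map (incl 𝒲) (incl 𝒲) ∘ₗ rLeibniz 𝒲 r G :=
    TensorProduct.ext' fun a b => by simp [rLeibniz, H_incl, incl_tw_rPar]
  have cH : IsCoder 𝒲 r H := fun x => by
    rw [eq_smul_one_add_incl 𝒲 x]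
    simp only [map_add, map_smul, H_one, H_incl, coprod_one, leibniz_tmul, coprod_incl, h,
      symTw_one]
    have e' := LinearMap.congr_fun e (rDiag 𝒲 (red 𝒲 x))
    simp only [LinearMap.comp_apply] at e'
    simp [e']
  have key := cH.eq_coext pH (fun x => by simp [H])
  refine LinearMap.ext fun x => incl_injective 𝒲 ?_
  rw [incl_hat, ← H_incl]
  exact LinearMap.congr_fun key _

end Reduced

/-! ### Cyclicity on the symmetric algebra and the bracket -/

section Cyclic

variable {K : Type*} [Field K] {W : Type*} [AddCommGroup W] [Module K W]
variable (𝒲 : ZMod 2 → Submodule K W) [DirectSum.Decomposition 𝒲] (ω : W →ₗ[K] W →ₗ[K] K)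

/-- A cochain `φ` of parity `r` on the symmetric algebra is cyclic for the form `ω` if
`ω(φ(u ⊙ x), w) = -(-1)^(|u|r) ω(u, φ(x ⊙ w))`. -/
def SymCyclic (r : ZMod 2) (φ : Sym 𝒲 →ₗ[K] W) : Prop :=
  ∀ (i : ZMod 2) (u w : W) (x : Sym 𝒲), u ∈ 𝒲 i →
    ω (φ (inc 𝒲 u * x)) w = -(sgn K (i * r) * ω u (φ (x * inc 𝒲 w)))

variable {𝒲 ω} {r s i : ZMod 2} {φ ψ : Sym 𝒲 →ₗ[K] W}

/-- The form for arbitrary `u`, needed because values such as `ψ(u ⊙ a)` take the place of `u`. -/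
theorem SymCyclic.apply (h : SymCyclic 𝒲 ω r φ) (u w : W) (x : Sym 𝒲) :
    ω (φ (inc 𝒲 u * x)) w = -ω (tw r (parityOp 𝒲) u) (φ (x * inc 𝒲 w)) := by
  have key : ∀ i, ω (φ (inc 𝒲 (grProj 𝒲 i u) * x)) w =
      -ω (tw r (parityOp 𝒲) (grProj 𝒲 i u)) (φ (x * inc 𝒲 w)) := fun i => by
    rw [h i _ w x (grProj_mem 𝒲 i u), tw_parityOp_of_mem 𝒲 (grProj_mem 𝒲 i u), mul_comm r i]
    simp
  rw [← grProj_add_grProj 𝒲 u]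
  simp only [map_add, add_mul, LinearMap.add_apply, key, neg_add]

/-- Moving `φ` and then `ψ` across the form turns `ω(φ(ψ(u ⊙ x') ⊙ x''), w)` into `ω(u, ψ(x' ⊙ φ(x''
⊙ w)))` up to sign. These are the terms of `φ̂(x ⊙ w)` with `w` inside `φ`, that is `φ̂(x ⊙ w) -
φ̂(x) ⊙ w`. -/
theorem SymCyclic.apply_coext (hφ : SymCyclic 𝒲 ω r φ) (hψ : SymCyclic 𝒲 ω s ψ)
    (pφ : CochainParity 𝒲 r φ) (pψ : CochainParity 𝒲 s ψ) {u : W} (hu : u ∈ 𝒲 i) (w : W)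
    (x : Sym 𝒲) :
    ω (φ (coext 𝒲 ψ (inc 𝒲 u * x))) w =
      sgn K (r * (s + i)) * sgn K (i * s) *
        (ω u (ψ (coext 𝒲 φ (x * inc 𝒲 w))) - ω u (ψ (coext 𝒲 φ x * inc 𝒲 w))) -
      sgn K (i * s) * sgn K (i * r) * ω u (φ (coext 𝒲 ψ x * inc 𝒲 w)) := by
  have e : ω.flip w ∘ₗ φ ∘ₗ LinearMap.mul' K (Sym 𝒲) ∘ₗ
      TensorProduct.map (inc 𝒲 ∘ₗ ψ ∘ₗ LinearMap.mulLeft K (inc 𝒲 u)) LinearMap.id =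
      (sgn K (r * (s + i)) * sgn K (i * s)) • (ω u ∘ₗ ψ ∘ₗ LinearMap.mul' K (Sym 𝒲) ∘ₗ
        TensorProduct.map (symTw 𝒲 r) (inc 𝒲 ∘ₗ φ ∘ₗ LinearMap.mulRight K (inc 𝒲 w))) := by
    refine TensorProduct.ext' fun a b => ?_
    have h1 : tw r (parityOp 𝒲) (ψ (inc 𝒲 u * a)) =
        sgn K (r * (s + i)) • ψ (inc 𝒲 u * symTw 𝒲 r a) :=
      (pψ.comp_mulLeft hu).tw_apply r a
    simp [hφ.apply, h1, hψ i u _ _ hu, mul_assoc]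
  have e' := LinearMap.congr_fun e (coprod 𝒲 x)
  simp only [LinearMap.comp_apply, LinearMap.smul_apply, LinearMap.flip_apply, smul_eq_mul] at e'
  have h2 := coext_mul_inc pφ w x
  rw [← sub_eq_iff_eq_add'] at h2
  rw [← h2, map_sub, map_sub] at e'
  rw [coext_inc_mul pψ hu, map_add, map_add, LinearMap.add_apply, map_smul, map_smul,
    LinearMap.smul_apply, hφ i u w _ hu, ← e', smul_eq_mul]
  change _ = ω (φ (coext 𝒲 _ x)) w - _
  ring

/-- A single composite is not cyclic in general: the terms with `φ̂(x) ⊙ w` and `ψ̂(x) ⊙ w`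
obstruct. In the graded commutator they cancel in pairs. -/
theorem SymCyclic.commutator (hφ : SymCyclic 𝒲 ω r φ) (hψ : SymCyclic 𝒲 ω s ψ)
    (pφ : CochainParity 𝒲 r φ) (pψ : CochainParity 𝒲 s ψ) :
    SymCyclic 𝒲 ω (r + s) (φ ∘ₗ coext 𝒲 ψ - sgn K (r * s) • (ψ ∘ₗ coext 𝒲 φ)) := by
  intro i u w x hu
  have e1 := hφ.apply_coext hψ pφ pψ hu w x
  have e2 := hψ.apply_coext hφ pψ pφ hu w x
  simp only [LinearMap.sub_apply, LinearMap.smul_apply, LinearMap.comp_apply, map_sub, map_smul,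
    smul_eq_mul, e1, e2, mul_add, sgn_add, mul_comm s r, mul_comm s i, mul_comm r i]
  linear_combination -(sgn K (i * s) * sgn K (i * r) * (ω u (φ (coext 𝒲 ψ (x * inc 𝒲 w))) -
    ω u (φ (coext 𝒲 ψ x * inc 𝒲 w)))) * sgn_mul_self (K := K) (r * s)

end Cyclic

/-! ### Monomials span the symmetric algebra -/

section Monomials

variable {K : Type*} [Field K] {W : Type*} [AddCommGroup W] [Module K W]
variable (𝒲 : ZMod 2 → Submodule K W) [DirectSum.Decomposition 𝒲]

/-- The product `w₁ ⊙ ⋯ ⊙ wₘ` in the symmetric algebra. -/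
abbrev symProd {m : ℕ} (v : Fin m → W) : Sym 𝒲 := (List.ofFn fun k => inc 𝒲 (v k)).prod

theorem symPar_symProd {m : ℕ} (j : Fin m → ZMod 2) (v : Fin m → W) (h : ∀ k, v k ∈ 𝒲 (j k)) :
    symPar 𝒲 (symProd 𝒲 v) = sgn K (∑ k, j k) • symProd 𝒲 v := by
  induction m with
  | zero => simp [symProd]
  | succ m ih =>
    have e := ih (fun k => j k.succ) (fun k => v k.succ) (fun k => h k.succ)
    rw [symProd, List.ofFn_succ, List.prod_cons, symPar_inc_mul 𝒲 (h 0), e, Fin.sum_univ_succ,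
      sgn_add, mul_smul_comm, smul_smul]

theorem symProd_induction {p : Sym 𝒲 → Prop}
    (prod : ∀ (m : ℕ) (j : Fin m → ZMod 2) (v : Fin m → W), (∀ k, v k ∈ 𝒲 (j k)) →
      p (symProd 𝒲 v))
    (add : ∀ x y, p x → p y → p (x + y)) (smul : ∀ (c : K) x, p x → p (c • x))
    (x : Sym 𝒲) : p x := by
  let S : Set (Sym 𝒲) := {x | ∃ (m : ℕ) (j : Fin m → ZMod 2) (v : Fin m → W),
    (∀ k, v k ∈ 𝒲 (j k)) ∧ x = symProd 𝒲 v}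
  have hS : ∀ x, x ∈ Submodule.span K S := by
    intro x
    induction x using sym_induction 𝒲 with
    | one => exact Submodule.subset_span ⟨0, 0, 0, fun k => k.elim0, by simp [symProd]⟩
    | inc_mul i w x hw hx =>
      induction hx using Submodule.span_induction with
      | mem x hx =>
        obtain ⟨m, j, v, hv, rfl⟩ := hx
        refine Submodule.subset_span ⟨m + 1, Fin.cons i j, Fin.cons w v, fun k => ?_, ?_⟩
        · refine Fin.cases ?_ (fun k => ?_) k
          · simpa using hw
          · simpa using hv k
        · simp [symProd]
      | zero => simp
      | add x y _ _ hx hy => rw [mul_add]; exact add_mem hx hy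
      | smul c x _ hx => rw [mul_smul_comm]; exact Submodule.smul_mem _ c hx
    | add x y hx hy => exact add_mem hx hy
    | smul c x hx => exact Submodule.smul_mem _ c hx
  induction hS x using Submodule.span_induction with
  | mem x hx =>
    obtain ⟨m, j, v, hv, rfl⟩ := hx
    exact prod m j v hv
  | zero => simpa using smul 0 _ (prod 0 0 0 fun k => k.elim0)
  | add x y _ _ hx hy => exact add x y hx hy
  | smul c x _ hx => exact smul c x hx

end Monomials

/-! ### Cyclicity in terms of components -/

section Components

variable {K : Type*} [Field K] {V : Type*} [AddCommGroup V] [Module K V]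
variable (𝒱 : ZMod 2 → Submodule K V)

theorem mem_rev_add_one {i : ZMod 2} {v : V} (hv : v ∈ 𝒱 i) : v ∈ rev 𝒱 (i + 1) :=
  le_rev 𝒱 i hv

/-- The arguments are split as first, middle block of length `m`, last. Both sides of the cyclicity
condition then share the middle block, and only the sign exponents differ. -/
theorem component_castSucc {X : Type*} [AddCommMonoid X] [Module K X] (φ : RSym (rev 𝒱) →ₗ[K] X)
    {m : ℕ} (i : Fin (m + 2) → ZMod 2) (v : Fin (m + 2) → V) :
    component 𝒱 φ (fun k => i (Fin.castSucc k)) (fun k => v (Fin.castSucc k)) =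
      sgn K (m * i 0 + ∑ k : Fin m, ((m - 1 - (k : ℕ) : ℕ) : ZMod 2) * i k.succ.castSucc) •
        φ (red (rev 𝒱) (inc (rev 𝒱) (v 0) * symProd (rev 𝒱) fun k => v k.succ.castSucc)) := by
  rw [component, Fin.sum_univ_succ, List.ofFn_succ, List.prod_cons]
  simp [Nat.sub_sub, add_comm]

theorem component_succ {X : Type*} [AddCommMonoid X] [Module K X] (φ : RSym (rev 𝒱) →ₗ[K] X)
    {m : ℕ} (i : Fin (m + 2) → ZMod 2) (v : Fin (m + 2) → V) :
    component 𝒱 φ (fun k => i (Fin.succ k)) (fun k => v (Fin.succ k)) =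
      sgn K ((∑ k : Fin m, ((m - 1 - (k : ℕ) : ℕ) : ZMod 2) * i k.succ.castSucc) +
          ∑ k : Fin m, i k.succ.castSucc) •
        φ (red (rev 𝒱) ((symProd (rev 𝒱) fun k => v k.succ.castSucc) *
          inc (rev 𝒱) (v (Fin.last (m + 1))))) := by
  have h : ∀ k : Fin m, ((m - (k : ℕ) : ℕ) : ZMod 2) = ((m - 1 - (k : ℕ) : ℕ) : ZMod 2) + 1 := by
    intro k
    rw [← Nat.cast_succ]
    congr 1
    omega
  rw [component, List.ofFn_succ', List.concat_eq_append, List.prod_append]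
  simp [Fin.sum_univ_castSucc, h, add_mul, Finset.sum_add_distrib]

variable [DirectSum.Decomposition 𝒱]

theorem parityOp_rev (v : V) : parityOp (rev 𝒱) v = -parityOp 𝒱 v := by
  induction v using DirectSum.Decomposition.inductionOn 𝒱 with
  | zero => simp
  | @homogeneous i v =>
    rw [parityOp_of_mem 𝒱 v.2, parityOp_of_mem (rev 𝒱) (mem_rev_add_one 𝒱 v.2), sgn_add]
    simp
  | add a b ha hb => rw [map_add, map_add, ha, hb, neg_add]

variable {𝒱} {B : LinearMap.BilinForm K V} {r : ZMod 2} {φ : Cochain 𝒱}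

theorem IsInnerProduct.apply_parityOp (hB : IsInnerProduct 𝒱 B) (x y : V) :
    B (parityOp 𝒱 x) y = B x (parityOp 𝒱 y) := by
  induction x using DirectSum.Decomposition.inductionOn 𝒱 with
  | zero => simp
  | @homogeneous i x =>
    induction y using DirectSum.Decomposition.inductionOn 𝒱 with
    | zero => simp
    | @homogeneous j y =>
      rw [parityOp_of_mem 𝒱 x.2, parityOp_of_mem 𝒱 y.2]
      by_cases h : i = j
      · simp [h]
      · simp [hB.even i j x y x.2 y.2 h]
    | add a b ha hb => simp only [map_add, ha, hb]
  | add a b ha hb => simp only [map_add, LinearMap.add_apply, ha, hb]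

/-- One instance of the component condition matches one instance of `SymCyclic`; the content is that
the shift signs `(-1)^((n-1)v₁ + ⋯)` and the sign in `ω` combine correctly. -/
theorem cyclic_iff_at [CharZero K] (hB : IsInnerProduct 𝒱 B)
    (hφ : HasParity (rPar (rev 𝒱)) (parityOp (rev 𝒱)) r φ) {m : ℕ} (i : Fin (m + 2) → ZMod 2)
    (v : Fin (m + 2) → V) (hv : ∀ k, v k ∈ 𝒱 (i k)) :
    B (component 𝒱 φ (fun k => i (Fin.castSucc k)) (fun k => v (Fin.castSucc k)))
        (v (Fin.last (m + 1))) =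
      sgn K (((m + 1 : ℕ) : ZMod 2) + i 0 * (r + (m + 1 : ℕ) + 1)) *
        B (v 0) (component 𝒱 φ (fun k => i (Fin.succ k)) (fun k => v (Fin.succ k))) ↔
    omega 𝒱 B ((φ ∘ₗ red (rev 𝒱)) (inc (rev 𝒱) (v 0) *
        symProd (rev 𝒱) fun k : Fin m => v k.succ.castSucc)) (v (Fin.last (m + 1))) =
      -(sgn K ((i 0 + 1) * r) * omega 𝒱 B (v 0) ((φ ∘ₗ red (rev 𝒱))
        ((symProd (rev 𝒱) fun k : Fin m => v k.succ.castSucc) *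
          inc (rev 𝒱) (v (Fin.last (m + 1)))))) := by
  rw [component_castSucc, component_succ]
  set X := symProd (rev 𝒱) fun k : Fin m => v k.succ.castSucc with hX
  set S := ∑ k : Fin m, ((m - 1 - (k : ℕ) : ℕ) : ZMod 2) * i k.succ.castSucc
  set T := ∑ k : Fin m, i k.succ.castSucc with hT
  set a := i 0 with ha
  set b := i (Fin.last (m + 1)) with hb
  set u := v 0
  set w := v (Fin.last (m + 1))
  have hu : u ∈ 𝒱 a := hv 0
  have hw : w ∈ 𝒱 b := hv _
  have pX : symPar (rev 𝒱) X = sgn K (T + m) • X := by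
    rw [hX, symPar_symProd (rev 𝒱) (fun k : Fin m => i k.succ.castSucc + 1) _
      fun k => mem_rev_add_one 𝒱 (hv _)]
    simp [Finset.sum_add_distrib, hT]
  have pφ := (cochainParity_comp_red hφ).apply
  -- The parity of `X` in `W` is `T + m`, one shift for each factor; the shifts of `w` and of the
  -- value cancel.
  have py : (φ ∘ₗ red (rev 𝒱)) (X * inc (rev 𝒱) w) ∈ 𝒱 (r + (T + m) + b) := by
    have h := pφ (X * inc (rev 𝒱) w)
    rw [AlgHom.toLinearMap_apply, map_mul (symPar (rev 𝒱)), pX, symPar_inc, parityOp_rev, parityOp_rev,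
      parityOp_of_mem 𝒱 hw] at h
    refine mem_of_parityOp_eq 𝒱 ?_
    rw [← neg_inj, h]
    simp [smul_smul, sgn_add, mul_left_comm, mul_comm]
  have e1 : omega 𝒱 B ((φ ∘ₗ red (rev 𝒱)) (inc (rev 𝒱) u * X)) w =
      sgn K b * B ((φ ∘ₗ red (rev 𝒱)) (inc (rev 𝒱) u * X)) w := by
    rw [omega, LinearMap.comp_apply, hB.apply_parityOp, parityOp_of_mem 𝒱 hw, map_smul,
      smul_eq_mul]
  have e2 : omega 𝒱 B u ((φ ∘ₗ red (rev 𝒱)) (X * inc (rev 𝒱) w)) =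
      sgn K a * B u ((φ ∘ₗ red (rev 𝒱)) (X * inc (rev 𝒱) w)) := by
    rw [omega, LinearMap.comp_apply, parityOp_of_mem 𝒱 hu, map_smul, LinearMap.smul_apply,
      smul_eq_mul]
  rw [e1, e2]
  simp only [map_smul, LinearMap.smul_apply, smul_eq_mul, LinearMap.comp_apply] at py ⊢
  set y := φ (red (rev 𝒱) (X * inc (rev 𝒱) w))
  set z := φ (red (rev 𝒱) (inc (rev 𝒱) u * X))
  -- The signs agree only under this parity constraint. Otherwise `B u y = 0` by evenness, and both
  -- conditions say that `B z w = 0`.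
  by_cases hab : a = r + (T + m) + b
  · have hs : sgn K (((m + 1 : ℕ) : ZMod 2) + a * (r + (m + 1 : ℕ) + 1)) * sgn K (S + T) =
        -(sgn K (m * a + S) * (sgn K b * (sgn K ((a + 1) * r) * sgn K a))) := by
      rw [neg_eq_neg_one_mul, ← sgn_one]
      simp only [← sgn_add, Nat.cast_succ]
      congr 1
      generalize (m : ZMod 2) = m' at *
      clear_value S T a b
      subst hab
      clear * -
      revert S T m' b r
      decide
    have hb' := sgn_ne_zero (K := K) b
    have hS := sgn_ne_zero (K := K) (m * a + S)
    have hbb := sgn_mul_self (K := K) b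
    rw [← mul_assoc, hs]
    constructor
    · intro h
      refine mul_left_cancel₀ hS ?_
      linear_combination sgn K b * h - sgn K (m * a + S) * sgn K ((a + 1) * r) * sgn K a *
        B u y * hbb
    · intro h
      linear_combination sgn K (m * a + S) * sgn K b * h - sgn K (m * a + S) * B z w * hbb
  · rw [hB.even _ _ u y hu py hab]
    simp [sgn_ne_zero]

theorem isCyclicCochain_iff [CharZero K] (hB : IsInnerProduct 𝒱 B)
    (hφ : HasParity (rPar (rev 𝒱)) (parityOp (rev 𝒱)) r φ) :
    IsCyclicCochain 𝒱 B r φ ↔ SymCyclic (rev 𝒱) (omega 𝒱 B) r (φ ∘ₗ red (rev 𝒱)) := by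
  constructor
  · intro h i u w x hu
    have hu' : u ∈ 𝒱 (i + 1) := hu
    have key : ∀ (b : ZMod 2) (w : V), w ∈ 𝒱 b →
        omega 𝒱 B ((φ ∘ₗ red (rev 𝒱)) (inc (rev 𝒱) u * x)) w =
        -(sgn K (i * r) * omega 𝒱 B u ((φ ∘ₗ red (rev 𝒱)) (x * inc (rev 𝒱) w))) := by
      intro b w hw
      induction x using symProd_induction (rev 𝒱) with
      | prod m j v hv =>
        -- For a monomial `x`, the component condition is applied to the sequence `u, v₁, …, vₘ, w`,
        -- with parities taken in `V`.
        have hvs : ∀ k, (Fin.cons u (Fin.snoc v w : Fin (m + 1) → V) : Fin (m + 2) → V) k ∈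
            𝒱 ((Fin.cons (i + 1) (Fin.snoc (fun k => j k + 1) b : Fin (m + 1) → ZMod 2) :
              Fin (m + 2) → ZMod 2) k) := by
          intro k
          refine Fin.cases ?_ (fun k => ?_) k
          · simpa using hu'
          · refine Fin.lastCases ?_ (fun k => ?_) k
            · simpa using hw
            · simpa using (show v k ∈ 𝒱 (j k + 1) from hv k)
        have e := (cyclic_iff_at hB hφ _ _ hvs).1 (h (m + 1) _ _ (Nat.le_add_left 1 m) hvs)
        have hi : i + 1 + 1 = i := by rw [add_assoc, zmod_two_add_self, add_zero]
        simpa [← Fin.succ_castSucc, ← Fin.succ_last, hi] using e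
      | add x y hx hy =>
        simp only [mul_add, add_mul, map_add, LinearMap.add_apply, hx, hy]
        ring
      | smul c x hx =>
        simp only [mul_smul_comm, smul_mul_assoc, map_smul, LinearMap.smul_apply, hx, smul_eq_mul]
        ring
    rw [← grProj_add_grProj 𝒱 w]
    simp only [map_add, mul_add, key _ _ (grProj_mem 𝒱 _ w), neg_add]
  · intro h n i v hn hv
    obtain ⟨m, rfl⟩ := Nat.exists_eq_add_of_le' hn
    exact (cyclic_iff_at hB hφ i v hv).2 (h _ _ _ _ (mem_rev_add_one 𝒱 (hv 0)))

theorem mem_CC_iff [CharZero K] (hB : IsInnerProduct 𝒱 B) : φ ∈ CC 𝒱 B r ↔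
    HasParity (rPar (rev 𝒱)) (parityOp (rev 𝒱)) r φ ∧
      SymCyclic (rev 𝒱) (omega 𝒱 B) r (φ ∘ₗ red (rev 𝒱)) :=
  and_congr_right fun h => isCyclicCochain_iff hB h

end Components

/-! ### The cyclic complex and the deformation conditions -/

section Complex

variable {K : Type*} [Field K] {V : Type*} [AddCommGroup V] [Module K V]
variable {𝒱 : ZMod 2 → Submodule K V} [DirectSum.Decomposition 𝒱]
variable {B : LinearMap.BilinForm K V} {l φ ψ : Cochain 𝒱} {r p : ZMod 2}

theorem cobd_apply (l φ : Cochain 𝒱) (r : ZMod 2) :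
    cobd 𝒱 l r φ = φ ∘ₗ hat (rev 𝒱) l - sgn K r • (l ∘ₗ hat (rev 𝒱) φ) := rfl

theorem defOp_apply (p : ZMod 2) (l φ : Cochain 𝒱) (z : RSym (rev 𝒱) × RSym (rev 𝒱)) :
    defOp 𝒱 p l φ z = (hat (rev 𝒱) l z.1,
      hat (rev 𝒱) φ z.1 + sgn K p • hat (rev 𝒱) l z.2) := by
  simp [defOp, opT]

theorem parT_apply {M : Type*} [AddCommMonoid M] [Module K M] (p : ZMod 2) (P : M →ₗ[K] M)
    (z : M × M) : parT p P z = (P z.1, sgn K p • P z.2) := rfl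

theorem hat_cobd [CharZero K] (hl : IsLInfty 𝒱 l)
    (hφ : HasParity (rPar (rev 𝒱)) (parityOp (rev 𝒱)) r φ) :
    hat (rev 𝒱) (cobd 𝒱 l r φ) =
      hat (rev 𝒱) φ ∘ₗ hat (rev 𝒱) l - sgn K r • (hat (rev 𝒱) l ∘ₗ hat (rev 𝒱) φ) := by
  simpa [cobd_apply] using (hat_commutator hφ hl.odd).symm

theorem hasParity_cobd (hl : IsLInfty 𝒱 l)
    (hφ : HasParity (rPar (rev 𝒱)) (parityOp (rev 𝒱)) r φ) :
    HasParity (rPar (rev 𝒱)) (parityOp (rev 𝒱)) (r + 1) (cobd 𝒱 l r φ) := by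
  rw [cobd_apply]
  exact (add_comm 1 r ▸ (hasParity_hat hl.odd).comp hφ).sub
    (((hasParity_hat hφ).comp hl.odd).smul _)

theorem cobd_mem_CC [CharZero K] (hB : IsInnerProduct 𝒱 B) (hl : IsLInfty 𝒱 l)
    (hinv : IsCyclicCochain 𝒱 B 1 l) (hφ : φ ∈ CC 𝒱 B r) : cobd 𝒱 l r φ ∈ CC 𝒱 B (r + 1) := by
  rw [mem_CC_iff hB] at hφ ⊢
  refine ⟨hasParity_cobd hl hφ.1, ?_⟩
  have h := hφ.2.commutator ((isCyclicCochain_iff hB hl.odd).1 hinv)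
    (cochainParity_comp_red hφ.1) (cochainParity_comp_red hl.odd)
  have e : cobd 𝒱 l r φ ∘ₗ red (rev 𝒱) =
      (φ ∘ₗ red (rev 𝒱)) ∘ₗ coext (rev 𝒱) (l ∘ₗ red (rev 𝒱)) -
        sgn K (r * 1) • ((l ∘ₗ red (rev 𝒱)) ∘ₗ coext (rev 𝒱) (φ ∘ₗ red (rev 𝒱))) :=
    LinearMap.ext fun x => by simp [cobd_apply, red_coext]
  rwa [e]

/-- The mixed terms `l φ̂ l̂` cancel; the others contain `l̂ l̂ = 0` or its degree one component `l
l̂ = 0`. -/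
theorem cobd_cobd [CharZero K] (hl : IsLInfty 𝒱 l)
    (hφ : HasParity (rPar (rev 𝒱)) (parityOp (rev 𝒱)) r φ) :
    cobd 𝒱 l (r + 1) (cobd 𝒱 l r φ) = 0 := by
  have h1 : ∀ x, hat (rev 𝒱) l (hat (rev 𝒱) l x) = 0 := LinearMap.congr_fun hl.sq_zero
  have h2 : ∀ x, l (hat (rev 𝒱) l x) = 0 := fun x => by
    rw [← degOne_incl_hat l, h1, map_zero, map_zero]
  refine LinearMap.ext fun x => ?_
  rw [cobd_apply, hat_cobd hl hφ, cobd_apply]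
  simp [h1, h2, sgn_add]

theorem isDeformation_iff [CharZero K] (hl : IsLInfty 𝒱 l) : IsDeformation 𝒱 p l φ ↔
    HasParity (rPar (rev 𝒱)) (parityOp (rev 𝒱)) (p + 1) φ ∧ cobd 𝒱 l (p + 1) φ = 0 := by
  have h1 : ∀ x, hat (rev 𝒱) l (hat (rev 𝒱) l x) = 0 := LinearMap.congr_fun hl.sq_zero
  have odd_iff : HasParity (parT p (rPar (rev 𝒱))) (parT p (rPar (rev 𝒱))) 1 (defOp 𝒱 p l φ) ↔
      HasParity (rPar (rev 𝒱)) (parityOp (rev 𝒱)) (p + 1) φ := by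
    constructor
    · intro h
      refine hasParity_of_hat (LinearMap.ext fun x => ?_)
      -- The second coordinate at `(x, 0)` is the coefficient of `t`, where `φ` first appears.
      have e := congrArg Prod.snd (h.apply (x, 0))
      simp only [defOp_apply, parT_apply, map_zero, smul_zero, add_zero, Prod.smul_mk] at e
      simp only [LinearMap.comp_apply, LinearMap.smul_apply, sgn_add, ← smul_smul]
      exact eq_sgn_smul_comm e.symm
    · rintro h
      refine LinearMap.ext fun ⟨x, y⟩ => ?_
      have e1 := (hasParity_hat h).apply
      have e2 := (hasParity_hat hl.odd).apply
      simp only [LinearMap.comp_apply, LinearMap.smul_apply, defOp_apply, parT_apply, map_add,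
        map_smul, e1, e2, Prod.smul_mk, sgn_add, smul_add, smul_smul, Prod.mk.injEq, true_and]
      congr 2
      · rw [← mul_assoc, sgn_mul_self, one_mul]
      · ring
  have sq_iff : HasParity (rPar (rev 𝒱)) (parityOp (rev 𝒱)) (p + 1) φ →
      (defOp 𝒱 p l φ ∘ₗ defOp 𝒱 p l φ = 0 ↔ cobd 𝒱 l (p + 1) φ = 0) := by
    intro hφ
    rw [← map_eq_zero_iff _ (hat_injective (𝒲 := rev 𝒱)), hat_cobd hl hφ]
    constructor
    · intro h
      refine LinearMap.ext fun x => ?_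
      have e := congrArg Prod.snd (LinearMap.congr_fun h (x, 0))
      simpa [defOp_apply, sgn_add] using e
    · intro h
      refine LinearMap.ext fun ⟨x, y⟩ => ?_
      have e := LinearMap.congr_fun h x
      ext1
      · simp [defOp_apply, h1]
      · simpa [defOp_apply, sgn_add, h1] using e
  exact ⟨fun h => ⟨odd_iff.1 h.odd, (sq_iff (odd_iff.1 h.odd)).1 h.sq_zero⟩,
    fun h => ⟨odd_iff.2 h.1, (sq_iff h.1).2 h.2⟩⟩

/-- The constant coefficient is the invariance for `l`. In the coefficient of `t`, moving `t` past
`v₀` gives `(-1)^(p i₀)`, which changes the sign for parity `n` into the one for the parity `p + n`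
of `φₙ`. -/
theorem deformationPreserves_iff (hinv : IsCyclicCochain 𝒱 B 1 l) :
    DeformationPreserves 𝒱 B p l φ ↔ IsCyclicCochain 𝒱 B (p + 1) φ := by
  refine forall₅_congr fun n i v hn hv => ?_
  have hc : ∀ (m : ℕ) (i : Fin m → ZMod 2) (v : Fin m → V),
      component 𝒱 (defCochain 𝒱 p l φ) i v =
        (component 𝒱 l i v, sgn K p • component 𝒱 φ i v) := fun m i v => by
    simp [component, defCochain, smul_comm (sgn K p)]
  have h1 := hinv n i v hn hv
  have hi : (1 : ZMod 2) + n + 1 = n := by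
    rw [add_right_comm, zmod_two_add_self, zero_add]
  have hi' : p + 1 + n + 1 = p + n := by
    rw [add_assoc, add_assoc, hi |> fun h => (add_assoc (1 : ZMod 2) n 1).symm.trans h]
  rw [hi] at h1
  rw [hc, hc, hi', mul_add, sgn_add, sgn_add, sgn_add]
  simp only [bilT, LinearMap.mk₂_apply, Prod.smul_mk, Prod.mk.injEq, map_zero, map_smul,
    LinearMap.smul_apply, smul_eq_mul, LinearMap.zero_apply, add_zero, zero_add,
    tw_parityOp_of_mem 𝒱 (hv 0)]
  rw [sgn_add] at h1
  simp only [h1, true_and]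
  have hp := sgn_mul_self (K := K) p
  rw [mul_comm p]
  constructor
  · intro h
    refine mul_left_cancel₀ (sgn_ne_zero (K := K) p) ?_
    linear_combination h
  · intro h
    linear_combination sgn K p * h

theorem mem_cocycles_iff [CharZero K] (hl : IsLInfty 𝒱 l) (hinv : IsCyclicCochain 𝒱 B 1 l) :
    φ ∈ cocycles 𝒱 B l (p + 1) ↔ IsDeformation 𝒱 p l φ ∧ DeformationPreserves 𝒱 B p l φ := by
  rw [isDeformation_iff hl, deformationPreserves_iff hinv, and_right_comm]
  rfl

theorem coboundaries_le [CharZero K] (hB : IsInnerProduct 𝒱 B) (hl : IsLInfty 𝒱 l)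
    (hinv : IsCyclicCochain 𝒱 B 1 l) (r : ZMod 2) :
    coboundaries 𝒱 B l r ≤ cocycles 𝒱 B l r := by
  rintro _ ⟨φ, hφ, rfl⟩
  have h : r + 1 + 1 = r := by rw [add_assoc, zmod_two_add_self, add_zero]
  have h1 := cobd_mem_CC hB hl hinv hφ
  have h2 := cobd_cobd hl hφ.1
  rw [h] at h1 h2
  exact ⟨h1, h2⟩

end Complex

/-! ### Infinitesimal automorphisms and equivalence -/

section Automorphisms

variable {K : Type*} [Field K] {V : Type*} [AddCommGroup V] [Module K V]
variable {𝒱 : ZMod 2 → Submodule K V} [DirectSum.Decomposition 𝒱]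
variable {B : LinearMap.BilinForm K V} {l φ ψ γ : Cochain 𝒱} {p : ZMod 2}

/-- The automorphism `1 + tG` of `M[t]`, `x + t y ↦ x + t (G x + y)`. -/
def oneAddT {M : Type*} [AddCommGroup M] [Module K M] (G : M →ₗ[K] M) : (M × M) ≃ₗ[K] (M × M) where
  toFun z := (z.1, G z.1 + z.2)
  invFun z := (z.1, z.2 - G z.1)
  map_add' a b := by ext <;> simp; abel
  map_smul' c a := by ext <;> simp
  left_inv z := by ext <;> simp
  right_inv z := by ext <;> simp

@[simp]
theorem oneAddT_apply {M : Type*} [AddCommGroup M] [Module K M] (G : M →ₗ[K] M) (z : M × M) :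
    oneAddT G z = (z.1, G z.1 + z.2) := rfl

theorem IsCoalgAut.exists_eq_oneAddT
    {F : (RSym (rev 𝒱) × RSym (rev 𝒱)) ≃ₗ[K] (RSym (rev 𝒱) × RSym (rev 𝒱))}
    (hF : IsCoalgAut 𝒱 p F) : ∃ G : RSym (rev 𝒱) →ₗ[K] RSym (rev 𝒱), F = oneAddT G := by
  refine ⟨LinearMap.snd K _ _ ∘ₗ F.toLinearMap ∘ₗ LinearMap.inl K _ _, LinearEquiv.ext fun z => ?_⟩
  have h1 : z = (z.1, 0) + mulT (K := K) (z.2, 0) := by ext <;> simp [mulT]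
  have h2 : F z = F (z.1, 0) + mulT (K := K) (F (z.2, 0)) := by
    conv_lhs => rw [h1]
    rw [map_add, hF.t_linear]
  rw [h2]
  ext1
  · simp [mulT, hF.id_mod_t]
  · simp [mulT, hF.id_mod_t]

theorem isCoalgAut_oneAddT_iff [CharZero K] {G : RSym (rev 𝒱) →ₗ[K] RSym (rev 𝒱)} :
    IsCoalgAut 𝒱 p (oneAddT G) ↔ ∃ γ : Cochain 𝒱,
      HasParity (rPar (rev 𝒱)) (parityOp (rev 𝒱)) p γ ∧ G = hat (rev 𝒱) γ := by
  -- The expansion of `(1 + tG)x' ⊗ (1 + tG)x''`: its coefficient of `t` is the Leibniz rule for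
  -- `G`.
  have hd : TensorProduct.lift
        ((bilT p (rPar (rev 𝒱)) (TensorProduct.mk K (RSym (rev 𝒱)) (RSym (rev 𝒱)))).compl₁₂
          ((oneAddT G).toLinearMap ∘ₗ LinearMap.inl K _ _)
          ((oneAddT G).toLinearMap ∘ₗ LinearMap.inl K _ _)) =
      LinearMap.prod LinearMap.id (rLeibniz (rev 𝒱) p G) :=
    TensorProduct.ext' fun a b => by simp [bilT, rLeibniz]
  constructor
  · intro h
    have pG : HasParity (rPar (rev 𝒱)) (rPar (rev 𝒱)) p G := LinearMap.ext fun x => by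
      have e := congrArg Prod.snd (h.even.apply (x, 0))
      simp [parT] at e
      simpa using (eq_sgn_smul_comm e.symm)
    have dG : ∀ x, rDiag (rev 𝒱) (G x) = rLeibniz (rev 𝒱) p G (rDiag (rev 𝒱) x) := fun x => by
      have e := congrArg Prod.snd (h.diag x)
      rw [hd] at e
      simpa using e
    refine ⟨_, ?_, eq_hat_of_rDiag pG dG⟩
    have e := pG.comp hasParity_degOne_incl
    rw [add_zero] at e
    exact e
  · rintro ⟨γ, hγ, rfl⟩
    refine ⟨LinearMap.ext fun z => ?_, fun z => by simp [mulT], fun z => rfl, fun x => ?_⟩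
    · have e := (hasParity_hat hγ).apply
      simp [parT, e, smul_smul]
    · rw [hd]
      simp [rDiag_hat hγ]

theorem degOne_mul_inc {W : Type*} [AddCommGroup W] [Module K W] (𝒲 : ZMod 2 → Submodule K W)
    [DirectSum.Decomposition 𝒲] (w : W) (x : Sym 𝒲) :
    degOne 𝒲 (x * inc 𝒲 w) = aug 𝒲 x • w := by
  induction x using sym_induction 𝒲 with
  | one => simp [degOne_inc]
  | inc_mul i v x hv ih => simp [mul_assoc]
  | add x y hx hy => simp only [add_mul, map_add, hx, hy, add_smul]
  | smul c x hx => simp only [smul_mul_assoc, map_smul, hx, smul_assoc]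

theorem autPreserves_oneAddT_hat :
    AutPreserves 𝒱 B p (oneAddT (hat (rev 𝒱) γ)) ↔
      SymCyclic (rev 𝒱) (omega 𝒱 B) p (γ ∘ₗ red (rev 𝒱)) := by
  have hf : ∀ x, autComponents 𝒱 (oneAddT (hat (rev 𝒱) γ)) x =
      (degOne (rev 𝒱) (incl (rev 𝒱) x), γ x) := fun x => by simp [autComponents]
  -- The constant part of `f` is the projection to degree one, so in each term of the coefficient of
  -- `t` one of `x'`, `x''` is a scalar, and the counits evaluate the sum.
  have key : ∀ (i : ZMod 2) (u w : V) (x : Sym (rev 𝒱)), u ∈ rev 𝒱 i →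
      TensorProduct.lift
        ((bilT p (parityOp (rev 𝒱)) (omega 𝒱 B)).compl₁₂
          (autComponents 𝒱 (oneAddT (hat (rev 𝒱) γ)) ∘ₗ red (rev 𝒱) ∘ₗ
            LinearMap.mulRight K (inc (rev 𝒱) u))
          (autComponents 𝒱 (oneAddT (hat (rev 𝒱) γ)) ∘ₗ red (rev 𝒱) ∘ₗ
            LinearMap.mulRight K (inc (rev 𝒱) w) ∘ₗ tw i (symPar (rev 𝒱)).toLinearMap))
        (coprod (rev 𝒱) x) = (aug (rev 𝒱) x * omega 𝒱 B u w,
          omega 𝒱 B (γ (red (rev 𝒱) (x * inc (rev 𝒱) u))) w +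
            sgn K (i * p) *
              omega 𝒱 B u (γ (red (rev 𝒱) (symTw (rev 𝒱) i x * inc (rev 𝒱) w)))) := by
    intro i u w x hu
    let R := (TensorProduct.rid K (Sym (rev 𝒱))).toLinearMap ∘ₗ
      TensorProduct.map LinearMap.id (aug (rev 𝒱)).toLinearMap
    let L := (TensorProduct.lid K (Sym (rev 𝒱))).toLinearMap ∘ₗ
      TensorProduct.map (aug (rev 𝒱)).toLinearMap LinearMap.id
    have e : TensorProduct.lift
        ((bilT p (parityOp (rev 𝒱)) (omega 𝒱 B)).compl₁₂
          (autComponents 𝒱 (oneAddT (hat (rev 𝒱) γ)) ∘ₗ red (rev 𝒱) ∘ₗ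
            LinearMap.mulRight K (inc (rev 𝒱) u))
          (autComponents 𝒱 (oneAddT (hat (rev 𝒱) γ)) ∘ₗ red (rev 𝒱) ∘ₗ
            LinearMap.mulRight K (inc (rev 𝒱) w) ∘ₗ symTw (rev 𝒱) i)) =
        LinearMap.prod (omega 𝒱 B u w • (aug (rev 𝒱)).toLinearMap ∘ₗ R)
          ((omega 𝒱 B).flip w ∘ₗ γ ∘ₗ red (rev 𝒱) ∘ₗ
              LinearMap.mulRight K (inc (rev 𝒱) u) ∘ₗ R +
            sgn K (i * p) • (omega 𝒱 B u ∘ₗ γ ∘ₗ red (rev 𝒱) ∘ₗ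
              LinearMap.mulRight K (inc (rev 𝒱) w) ∘ₗ symTw (rev 𝒱) i ∘ₗ L)) := by
      refine TensorProduct.ext' fun a b => ?_
      have hu' := tw_parityOp_of_mem (rev 𝒱) hu p
      ext1
      · simp [hf, bilT, R, degOne_mul_inc]
        ring
      · simp [hf, bilT, R, L, degOne_mul_inc, hu', mul_comm p i]
        ring
    refine (LinearMap.congr_fun e _).trans ?_
    have hR : R (coprod (rev 𝒱) x) = x := counit_right (rev 𝒱) x
    have hL : L (coprod (rev 𝒱) x) = x := counit_left (rev 𝒱) x
    simp [hR, hL, mul_comm]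
  constructor
  · intro h i u w x hu
    -- In the definition `u` stands to the right of `x'`, in `SymCyclic` to the left of `x`;
    -- replacing `x` by its twist absorbs the commutation sign.
    have e := congrArg Prod.snd ((key i u w (symTw (rev 𝒱) i x) hu).symm.trans
      (h (symTw (rev 𝒱) i x) i u w hu))
    rw [mul_inc (rev 𝒱) hu, symTw_symTw_self] at e
    exact eq_neg_of_add_eq_zero_left e
  · intro h x i u w hu
    refine (key i u w x hu).trans (Prod.ext rfl ?_)
    have e := h i u w (symTw (rev 𝒱) i x) hu
    rw [← mul_inc (rev 𝒱) hu] at e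
    exact add_eq_zero_iff_eq_neg.2 e

theorem equivalent_iff [CharZero K] (hB : IsInnerProduct 𝒱 B) (hl : IsLInfty 𝒱 l) :
    Equivalent 𝒱 B p l φ ψ ↔ ψ - φ ∈ coboundaries 𝒱 B l (p + 1) := by
  have hpp : p + 1 + 1 = p := by rw [add_assoc, zmod_two_add_self, add_zero]
  have hc : ∀ γ : Cochain 𝒱, HasParity (rPar (rev 𝒱)) (parityOp (rev 𝒱)) p γ →
      ((oneAddT (hat (rev 𝒱) γ)).toLinearMap ∘ₗ defOp 𝒱 p l φ =
        defOp 𝒱 p l ψ ∘ₗ (oneAddT (hat (rev 𝒱) γ)).toLinearMap ↔ cobd 𝒱 l p γ = ψ - φ) := by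
    intro γ hγ
    rw [← (hat_injective (𝒲 := rev 𝒱)).eq_iff, hat_cobd hl hγ, map_sub]
    constructor
    · intro h
      refine LinearMap.ext fun x => ?_
      -- The coefficient of `t` reads `γ̂ l̂ + φ̂ = ψ̂ + (-1)^p l̂ γ̂`.
      have e := congrArg Prod.snd (LinearMap.congr_fun h (x, 0))
      simp [defOp_apply] at e
      simp only [LinearMap.sub_apply, LinearMap.smul_apply, LinearMap.comp_apply]
      rw [sub_eq_sub_iff_add_eq_add, e, add_comm]
    · intro h
      refine LinearMap.ext fun z => ?_
      have e := LinearMap.congr_fun h z.1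
      simp only [LinearMap.sub_apply, LinearMap.smul_apply, LinearMap.comp_apply] at e
      rw [sub_eq_sub_iff_add_eq_add] at e
      ext1
      · simp [defOp_apply]
      · simp [defOp_apply]
        rw [← add_assoc, e]
        abel
  rw [coboundaries, hpp]
  constructor
  · rintro ⟨F, hF, hFB, hF'⟩
    obtain ⟨G, rfl⟩ := hF.exists_eq_oneAddT
    obtain ⟨γ, hγ, rfl⟩ := isCoalgAut_oneAddT_iff.1 hF
    exact ⟨γ, (mem_CC_iff hB).2 ⟨hγ, autPreserves_oneAddT_hat.1 hFB⟩, (hc γ hγ).1 hF'⟩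
  · rintro ⟨γ, hγ, e⟩
    have h := (mem_CC_iff hB).1 hγ
    exact ⟨oneAddT (hat (rev 𝒱) γ), isCoalgAut_oneAddT_iff.2 ⟨γ, h.1, rfl⟩,
      autPreserves_oneAddT_hat.2 h.2, (hc γ h.1).2 e⟩

end Automorphisms

end LInf

end

/-! ### The classification theorem -/

open LInf
theorem mainTheorem7 {K : Type*} [Field K] [CharZero K] {V : Type*} [AddCommGroup V] [Module K V]
    (𝒱 : ZMod 2 → Submodule K V) [DirectSum.Decomposition 𝒱]
    (B : LinearMap.BilinForm K V) (hB : IsInnerProduct 𝒱 B)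
    (l : Cochain 𝒱) (hl : IsLInfty 𝒱 l) (hinv : IsCyclicCochain 𝒱 B 1 l) :
    -- the cyclic cochains form a complex
    (∀ (r : ZMod 2), ∀ φ ∈ CC 𝒱 B r,
      cobd 𝒱 l r φ ∈ CC 𝒱 B (r + 1) ∧ cobd 𝒱 l (r + 1) (cobd 𝒱 l r φ) = 0) ∧
    ∀ p : ZMod 2,
      -- cyclic cocycles are the infinitesimal deformations that preserve the inner product
      (∀ φ : Cochain 𝒱, φ ∈ cocycles 𝒱 B l (p + 1) ↔
        IsDeformation 𝒱 p l φ ∧ DeformationPreserves 𝒱 B p l φ) ∧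
      -- cyclic coboundaries are the trivial ones
      (∀ φ : Cochain 𝒱, φ ∈ coboundaries 𝒱 B l (p + 1) ↔
        (IsDeformation 𝒱 p l φ ∧ DeformationPreserves 𝒱 B p l φ) ∧
          Equivalent 𝒱 B p l 0 φ) ∧
      -- two deformations are equivalent exactly if they differ by a cyclic coboundary
      (∀ φ ψ : Deformation 𝒱 B l p,
        Equivalent 𝒱 B p l φ.1 ψ.1 ↔ ψ.1 - φ.1 ∈ coboundaries 𝒱 B l (p + 1)) ∧
      -- the cyclic cohomology classifies the deformations up to equivalence
      ∃ e : HC 𝒱 B l (p + 1) ≃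
          Quot (fun φ ψ : Deformation 𝒱 B l p => Equivalent 𝒱 B p l φ.1 ψ.1),
        ∀ (φ : Cochain 𝒱) (hz : φ ∈ cocycles 𝒱 B l (p + 1))
          (hd : IsDeformation 𝒱 p l φ ∧ DeformationPreserves 𝒱 B p l φ),
          e (Submodule.Quotient.mk ⟨φ, hz⟩) = Quot.mk _ ⟨φ, hd⟩ := by
  refine ⟨fun r φ hφ => ⟨cobd_mem_CC hB hl hinv hφ, cobd_cobd hl hφ.1⟩, fun p =>
    ⟨fun φ => mem_cocycles_iff hl hinv, fun φ => ?_, fun φ ψ => equivalent_iff hB hl, ?_⟩⟩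
  · rw [equivalent_iff hB hl, sub_zero]
    exact ⟨fun h => ⟨(mem_cocycles_iff hl hinv).1 (coboundaries_le hB hl hinv _ h), h⟩,
      fun h => h.2⟩
  -- Cocycles and deformations are the same cochains, so it suffices to match the relations; they
  -- differ only in the order of the difference, hence the negation.
  · refine ⟨Quot.congr (Equiv.subtypeEquivRight fun φ => mem_cocycles_iff hl hinv)
      fun φ ψ => ?_, fun φ hz hd => rfl⟩
    refine (Submodule.quotientRel_def _).trans (Iff.trans ?_ (equivalent_iff hB hl).symm)
    rw [← neg_mem_iff, neg_sub]
    rfl
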